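/- For every real number $\varepsilon$ with $0<\varepsilon<1$ there exists $\beta=\beta(\varepsilon)>0$ such that the following holds. For every real $c>0$ there is $N=N(\varepsilon,c)$ such that for every integer $n\ge N$, every (finite, simple) graph $G$ on $n$ vertices with at least $c\,n^{1+\varepsilon}$ edges contains a regular subgraph $H$ (not necessarily induced or spanning; regular means that all vertices of $H$ have the same degree in $H$) such that, writing $m$ for the number of vertices of $H$, we have $m\ge n^{\beta}$ and $H$ has at least $\beta c\, m^{1+\varepsilon}$ edges. -/

import Mathlib

universe u

/-- A subgraph `H` (with its own vertex set `H.verts`) of a graph on a finite vertex type is regular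
if all its vertices have the same degree in `H`. -/
def SubgraphIsRegular {V : Type u} {G : SimpleGraph V} (H : G.Subgraph) : Prop :=
  ∃ r : ℕ, ∀ v ∈ H.verts, (H.neighborSet v).ncard = r

/-! Put `a = ε / 2`, pass to a bipartite half of `G`, and let `W₀`, of size `m`, maximise w(W,W) /
|W|^(1+a), with maximum `ρ`. Then ρ ≥ c n^a, and the average degree d = ρ m^a inside `W₀` is at
least c n^a, polynomial in `n`. Extremality makes small sets sparse: a set of size at most m / L has
average degree at most d / L^a. If U ⊆ W₀, then d ≥ c |U|^a · |U|^a = c |U|^ε, so it suffices to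
find in `W₀` a regular subgraph of degree of order `d`. Such a degree also forces polynomially many
vertices.

Extremality first gives a subset with all degrees between d / 4 and K d
(`exists_almost_regular_subset`). Sampling its vertices with probability proportional to degree, and
reweighting edges inversely to the degrees of both ends, equalises all expected degrees; since `d`
is polynomial, a Chernoff bound makes every weighted degree (1 ± γ) R with `R` of order `d`
(`exists_nearly_regular_sample`).

Near-regularity does not yet give a factor. Cutting along light cuts must stop after boundedly many
rounds, because every piece kept has at least m / L vertices; the final piece has large cuts far
heavier than its boundary (`exists_large_cuts_of_small_boundary`). Few deletions balance its sides
and raise its minimum degree. Small cuts then dominate the degree deficit because small sets are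
sparse, large cuts because the total deficit is comparable with the boundary
(`exists_balanced_hall`). Such cut bounds imply the Ore–Ryser condition (`hall_of_cut_ge_deficit`),
and Hall's theorem yields the factor (`exists_regular_factor`). -/

/-! ### Regular factors from Hall's theorem. -/

/-- A bipartite graph with equal sides, satisfying the Ore–Ryser condition for `r`, has an
`r`-regular spanning subgraph. -/
theorem exists_regular_factor {V : Type*} [DecidableEq V] (E : Finset (V × V)) (A B : Finset V)
    (hE : E ⊆ A ×ˢ B) (hcard : A.card = B.card) (r : ℕ)
    (hall : ∀ X ⊆ A, ∀ Z ⊆ B,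
      r * X.card ≤ r * Z.card + (E.filter fun e => e.1 ∈ X ∧ e.2 ∉ Z).card) :
    ∃ F ⊆ E, (∀ a ∈ A, (F.filter fun e => e.1 = a).card = r) ∧
      ∀ b ∈ B, (F.filter fun e => e.2 = b).card = r := by
  classical
  set deg : V → ℕ := fun b => (E.filter fun e => e.2 = b).card with hdeg
  have hrdeg : ∀ b ∈ B, r ≤ deg b := by
    intro b hb
    have h := hall A subset_rfl (B.erase b) (Finset.erase_subset _ _)
    have h1 : (E.filter fun e => e.1 ∈ A ∧ e.2 ∉ B.erase b).card ≤ deg b := by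
      apply Finset.card_le_card
      intro e he
      rw [Finset.mem_filter] at he ⊢
      refine ⟨he.1, ?_⟩
      have := Finset.mem_product.1 (hE he.1)
      by_contra hne
      exact he.2.2 (Finset.mem_erase.2 ⟨hne, this.2⟩)
    have h2 : (B.erase b).card + 1 = A.card := by rw [hcard, Finset.card_erase_add_one hb]
    rw [← h2, mul_add] at h
    omega
  have hEcard : E.card = ∑ b ∈ B, deg b :=
    Finset.card_eq_sum_card_fiberwise fun e he => (Finset.mem_product.1 (hE he)).2
  -- Each `a` claims `r` edges to keep and each `b` claims `deg b - r` edges to discard. As there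
  -- are exactly |E| claims, a system of distinct representatives uses every edge, so exactly `r`
  -- kept edges remain at each `b`.
  let ι := (A × Fin r) ⊕ (Σ b : B, Fin (deg b - r))
  let t : ι → Finset (V × V) := fun x => match x with
    | Sum.inl y => E.filter fun e => e.1 = y.1
    | Sum.inr y => E.filter fun e => e.2 = y.1
  have hιcard : Fintype.card ι = E.card := by
    have h1 : Fintype.card ι = A.card * r + ∑ b : B, (deg b - r) := by
      simp [ι, Fintype.card_sum, Fintype.card_sigma]
    have h2 : ∑ b : B, (deg b - r) = ∑ b ∈ B, (deg b - r) :=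
      Finset.sum_coe_sort B fun b => deg b - r
    have h3 : ∑ b ∈ B, (deg b - r) + ∑ _b ∈ B, r = ∑ b ∈ B, deg b := by
      rw [← Finset.sum_add_distrib]
      exact Finset.sum_congr rfl fun b hb => Nat.sub_add_cancel (hrdeg b hb)
    rw [Finset.sum_const, smul_eq_mul] at h3
    rw [h1, h2, hEcard, ← h3, hcard]
    ring
  have hHall : ∀ s : Finset ι, s.card ≤ (s.biUnion t).card := by
    intro s
    set X : Finset A := Finset.univ.filter fun a => ∃ i, Sum.inl (a, i) ∈ s with hX
    set Y : Finset B := Finset.univ.filter fun b => ∃ i, Sum.inr ⟨b, i⟩ ∈ s with hY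
    have hs : s ⊆ (X ×ˢ (Finset.univ : Finset (Fin r))).disjSum
        (Y.sigma fun b => (Finset.univ : Finset (Fin (deg b - r)))) := by
      rintro (⟨a, i⟩ | ⟨b, i⟩) hx
      · exact Finset.inl_mem_disjSum.2 (Finset.mem_product.2
          ⟨Finset.mem_filter.2 ⟨Finset.mem_univ _, i, hx⟩, Finset.mem_univ _⟩)
      · exact Finset.inr_mem_disjSum.2 (Finset.mem_sigma.2
          ⟨Finset.mem_filter.2 ⟨Finset.mem_univ _, i, hx⟩, Finset.mem_univ _⟩)
    have hscard := Finset.card_le_card hs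
    rw [Finset.card_disjSum, Finset.card_product, Finset.card_sigma] at hscard
    simp only [Finset.card_univ, Fintype.card_fin] at hscard
    set X' : Finset V := X.map (Function.Embedding.subtype _) with hX'
    set Y' : Finset V := Y.map (Function.Embedding.subtype _) with hY'
    have hX'A : X' ⊆ A := by
      intro x hx
      obtain ⟨a, -, rfl⟩ := Finset.mem_map.1 hx
      exact a.2
    have hY'B : Y' ⊆ B := by
      intro x hx
      obtain ⟨a, -, rfl⟩ := Finset.mem_map.1 hx
      exact a.2
    have hYsum : ∑ b ∈ Y, (deg b - r) = ∑ b ∈ Y', (deg b - r) := by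
      rw [hY', Finset.sum_map]; rfl
    -- The edges available to `s` include all edges at `Y'` and those from `X'` that avoid `Y'`;
    -- after cancelling the degree sums over `Y'`, Hall's inequality is `hall` for this pair.
    have hsub : (E.filter fun e => e.2 ∈ Y') ∪ (E.filter fun e => e.1 ∈ X' ∧ e.2 ∉ Y') ⊆
        s.biUnion t := by
      intro e he
      rw [Finset.mem_union, Finset.mem_filter, Finset.mem_filter] at he
      rw [Finset.mem_biUnion]
      rcases he with ⟨he, h⟩ | ⟨he, h, -⟩
      · obtain ⟨b, hb, hbe⟩ := Finset.mem_map.1 h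
        obtain ⟨i, hi⟩ := (Finset.mem_filter.1 hb).2
        exact ⟨_, hi, Finset.mem_filter.2 ⟨he, hbe.symm⟩⟩
      · obtain ⟨b, hb, hbe⟩ := Finset.mem_map.1 h
        obtain ⟨i, hi⟩ := (Finset.mem_filter.1 hb).2
        exact ⟨_, hi, Finset.mem_filter.2 ⟨he, hbe.symm⟩⟩
    have hcardU := Finset.card_le_card hsub
    rw [Finset.card_union_of_disjoint] at hcardU
    swap
    · rw [Finset.disjoint_left]
      intro e h1 h2
      exact (Finset.mem_filter.1 h2).2.2 (Finset.mem_filter.1 h1).2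
    have h4 : (E.filter fun e => e.2 ∈ Y').card = ∑ b ∈ Y', deg b := by
      have hfib : ∀ e ∈ E.filter fun e => e.2 ∈ Y', e.2 ∈ Y' :=
        fun e he => (Finset.mem_filter.1 he).2
      rw [Finset.card_eq_sum_card_fiberwise (f := Prod.snd) (t := Y') hfib]
      refine Finset.sum_congr rfl fun b hb => ?_
      rw [Finset.filter_filter, hdeg]
      congr 1
      ext e
      simp only [Finset.mem_filter]
      constructor
      · rintro ⟨h1, -, h2⟩; exact ⟨h1, h2⟩
      · rintro ⟨h1, h2⟩; exact ⟨h1, h2 ▸ hb, h2⟩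
    have h3 : ∑ b ∈ Y', (deg b - r) + ∑ _b ∈ Y', r = ∑ b ∈ Y', deg b := by
      rw [← Finset.sum_add_distrib]
      exact Finset.sum_congr rfl fun b hb => Nat.sub_add_cancel (hrdeg b (hY'B hb))
    rw [Finset.sum_const, smul_eq_mul] at h3
    have h5 := hall X' hX'A Y' hY'B
    have h6 : X'.card = X.card := Finset.card_map _
    rw [hYsum] at hscard
    rw [h4] at hcardU
    rw [h6] at h5
    rw [mul_comm] at h3
    have h7 : r * X.card = X.card * r := mul_comm _ _
    have h8 : r * Y'.card = Y'.card * r := mul_comm _ _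
    omega
  obtain ⟨f, hfinj, hft⟩ := (Finset.all_card_le_biUnion_card_iff_exists_injective t).1 hHall
  have hfE : ∀ x, f x ∈ E := by
    intro x
    have := hft x
    rcases x with x | x <;> exact (Finset.mem_filter.1 this).1
  have hfl : ∀ a i, (f (Sum.inl (a, i))).1 = a := fun a i => (Finset.mem_filter.1 (hft (Sum.inl (a, i)))).2
  have hfr : ∀ b i, (f (Sum.inr ⟨b, i⟩)).2 = b := fun b i => (Finset.mem_filter.1 (hft (Sum.inr ⟨b, i⟩))).2
  have himg : Finset.univ.image f = E := by
    apply Finset.eq_of_subset_of_card_le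
    · intro e he
      obtain ⟨x, -, rfl⟩ := Finset.mem_image.1 he
      exact hfE x
    · rw [Finset.card_image_of_injective _ hfinj, Finset.card_univ, hιcard]
  refine ⟨Finset.univ.image fun y : A × Fin r => f (Sum.inl y), ?_, ?_, ?_⟩
  · intro e he
    obtain ⟨x, -, rfl⟩ := Finset.mem_image.1 he
    exact hfE _
  · intro a ha
    have : (Finset.univ.image fun y : A × Fin r => f (Sum.inl y)).filter (fun e => e.1 = a) =
        Finset.univ.image fun i : Fin r => f (Sum.inl (⟨a, ha⟩, i)) := by
      ext e
      simp only [Finset.mem_filter, Finset.mem_image, Finset.mem_univ, true_and]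
      constructor
      · rintro ⟨⟨⟨a', i⟩, rfl⟩, h⟩
        rw [hfl] at h
        obtain rfl : a' = ⟨a, ha⟩ := Subtype.ext h
        exact ⟨i, rfl⟩
      · rintro ⟨i, rfl⟩
        exact ⟨⟨_, rfl⟩, hfl _ _⟩
    rw [this, Finset.card_image_of_injective, Finset.card_univ, Fintype.card_fin]
    intro i j hij
    exact (Prod.ext_iff.1 (Sum.inl.inj (hfinj hij))).2
  · intro b hb
    set F := Finset.univ.image fun y : A × Fin r => f (Sum.inl y) with hF
    have hunion : (E.filter fun e => e.2 = b) = (F.filter fun e => e.2 = b) ∪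
        Finset.univ.image fun i : Fin (deg b - r) => f (Sum.inr ⟨⟨b, hb⟩, i⟩) := by
      ext e
      simp only [Finset.mem_filter, Finset.mem_image, Finset.mem_univ, true_and, Finset.mem_union,
        hF]
      constructor
      · rintro ⟨he, h⟩
        rw [← himg] at he
        obtain ⟨x, -, rfl⟩ := Finset.mem_image.1 he
        rcases x with x | ⟨b', i⟩
        · exact Or.inl ⟨⟨x, rfl⟩, h⟩
        · rw [hfr] at h
          obtain rfl : b' = ⟨b, hb⟩ := Subtype.ext h
          exact Or.inr ⟨i, rfl⟩
      · rintro (⟨⟨x, rfl⟩, h⟩ | ⟨i, rfl⟩)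
        · exact ⟨hfE _, h⟩
        · exact ⟨hfE _, hfr _ _⟩
    have hdis : Disjoint (F.filter fun e => e.2 = b)
        (Finset.univ.image fun i : Fin (deg b - r) => f (Sum.inr ⟨⟨b, hb⟩, i⟩)) := by
      rw [Finset.disjoint_left]
      intro e h1 h2
      obtain ⟨x, -, rfl⟩ := Finset.mem_image.1 (Finset.mem_filter.1 h1).1
      obtain ⟨y, -, hy⟩ := Finset.mem_image.1 h2
      exact absurd (hfinj hy) (by simp)
    have hc := congrArg Finset.card hunion
    rw [Finset.card_union_of_disjoint hdis, Finset.card_image_of_injective, Finset.card_univ,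
      Fintype.card_fin] at hc
    · have := hrdeg b hb
      change deg b = _ at hc
      omega
    · intro i j hij
      have := Sum.inr.inj (hfinj hij)
      simpa using this

/-! ### Concentration of random subset sums. -/

/-- Exponential moment of a random subset sum. -/
theorem sum_powerset_prod_mul_exp {V : Type*} [Fintype V] [DecidableEq V] (p g : V → ℝ) :
    ∑ S ∈ (Finset.univ : Finset V).powerset,
      ((∏ u ∈ S, p u) * ∏ u ∈ Finset.univ \ S, (1 - p u)) * Real.exp (∑ u ∈ S, g u) =
      ∏ u, (p u * Real.exp (g u) + (1 - p u)) := by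
  rw [Finset.prod_add]
  refine Finset.sum_congr rfl fun S _ => ?_
  rw [Real.exp_sum, Finset.prod_mul_distrib]
  ring

/-- For |x| ≤ 1, exp x ≤ 1 + x + x²; since 0 ≤ f ≤ 1 gives f² ≤ f, each factor is at most 1 + (l +
l²) p f, hence at most its exponential. -/
theorem sum_powerset_prod_mul_exp_le {V : Type*} [Fintype V] [DecidableEq V] (p f : V → ℝ)
    (hp0 : ∀ u, 0 ≤ p u) (hp1 : ∀ u, p u ≤ 1) (hf0 : ∀ u, 0 ≤ f u) (hf1 : ∀ u, f u ≤ 1)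
    (R : ℝ) (hR : ∑ u, p u * f u = R) (l : ℝ) (hl : |l| ≤ 1) :
    ∑ S ∈ (Finset.univ : Finset V).powerset,
      ((∏ u ∈ S, p u) * ∏ u ∈ Finset.univ \ S, (1 - p u)) * Real.exp (l * ∑ u ∈ S, f u) ≤
      Real.exp ((l + l ^ 2) * R) := by
  simp_rw [Finset.mul_sum]
  rw [sum_powerset_prod_mul_exp p fun u => l * f u]
  rw [← hR, Finset.mul_sum, Real.exp_sum]
  refine Finset.prod_le_prod (fun u _ => ?_) fun u _ => ?_
  · have := mul_nonneg (hp0 u) (Real.exp_pos (l * f u)).le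
    linarith [hp1 u]
  · have h1 : |l * f u| ≤ 1 := by
      rw [abs_mul, abs_of_nonneg (hf0 u)]
      nlinarith [abs_nonneg l, hf0 u, hf1 u]
    have h2 := (abs_le.1 (Real.abs_exp_sub_one_sub_id_le h1)).2
    have h3 : (l * f u) ^ 2 ≤ l ^ 2 * f u := by
      rw [mul_pow]
      exact mul_le_mul_of_nonneg_left (by nlinarith [hf0 u, hf1 u]) (sq_nonneg l)
    have h4 := Real.add_one_le_exp ((l + l ^ 2) * (p u * f u))
    have h5 : p u * (Real.exp (l * f u) - 1) ≤ p u * (l * f u + l ^ 2 * f u) :=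
      mul_le_mul_of_nonneg_left (by linarith) (hp0 u)
    nlinarith

/-- A random subset including `u` with probability `p u` is simultaneously concentrated with
respect to few weight functions of the same mean. -/
theorem exists_subset_sum_concentrated {V T : Type*} [Fintype V] (p : V → ℝ)
    (hp0 : ∀ u, 0 ≤ p u) (hp1 : ∀ u, p u ≤ 1) (I : Finset T) (f : T → V → ℝ)
    (hf0 : ∀ t ∈ I, ∀ u, 0 ≤ f t u) (hf1 : ∀ t ∈ I, ∀ u, f t u ≤ 1) (R : ℝ)
    (hR : ∀ t ∈ I, ∑ u, p u * f t u = R) (γ : ℝ) (hγ0 : 0 < γ) (hγ1 : γ ≤ 1)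
    (hsmall : (I.card : ℝ) * (2 * Real.exp (-(γ ^ 2 * R / 4))) < 1) :
    ∃ S : Finset V, ∀ t ∈ I,
      (1 - γ) * R ≤ ∑ u ∈ S, f t u ∧ ∑ u ∈ S, f t u ≤ (1 + γ) * R := by
  classical
  set μ : Finset V → ℝ := fun S => (∏ u ∈ S, p u) * ∏ u ∈ Finset.univ \ S, (1 - p u) with hμ
  have hμ0 : ∀ S, 0 ≤ μ S := fun S => mul_nonneg (Finset.prod_nonneg fun u _ => hp0 u)
    (Finset.prod_nonneg fun u _ => sub_nonneg.2 (hp1 u))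
  have hμ1 : ∑ S ∈ (Finset.univ : Finset V).powerset, μ S = 1 := by
    have := sum_powerset_prod_mul_exp p (fun _ => 0)
    simpa using this
  -- This minimises l² - l γ, the coefficient of `R` in both tail exponents, with value -γ² / 4.
  set l : ℝ := γ / 2 with hl
  have hl1 : |l| ≤ 1 := by rw [abs_of_pos (by positivity)]; linarith
  have hl2 : |-l| ≤ 1 := by rwa [abs_neg]
  -- Each summand is at least 1 when its tail inequality fails, so a set with total penalty below 1
  -- has no failure.
  set bad : T → Finset V → ℝ := fun t S =>
    Real.exp (l * ∑ u ∈ S, f t u - l * ((1 + γ) * R)) +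
      Real.exp (-l * ∑ u ∈ S, f t u + l * ((1 - γ) * R)) with hbad
  have hbadsum : ∀ t ∈ I, ∑ S ∈ (Finset.univ : Finset V).powerset, μ S * bad t S ≤
      2 * Real.exp (-(γ ^ 2 * R / 4)) := by
    intro t ht
    have h1 := sum_powerset_prod_mul_exp_le p (f t) hp0 hp1 (hf0 t ht) (hf1 t ht) R (hR t ht) l hl1
    have h2 := sum_powerset_prod_mul_exp_le p (f t) hp0 hp1 (hf0 t ht) (hf1 t ht) R (hR t ht) (-l) hl2
    have e1 : ∑ S ∈ (Finset.univ : Finset V).powerset, μ S * bad t S =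
        (∑ S ∈ (Finset.univ : Finset V).powerset, μ S * Real.exp (l * ∑ u ∈ S, f t u)) *
          Real.exp (-(l * ((1 + γ) * R))) +
        (∑ S ∈ (Finset.univ : Finset V).powerset, μ S * Real.exp (-l * ∑ u ∈ S, f t u)) *
          Real.exp (l * ((1 - γ) * R)) := by
      rw [Finset.sum_mul, Finset.sum_mul, ← Finset.sum_add_distrib]
      refine Finset.sum_congr rfl fun S _ => ?_
      rw [hbad]
      simp only [sub_eq_add_neg, Real.exp_add]
      ring
    rw [e1, two_mul]
    refine add_le_add ?_ ?_
    · refine (mul_le_mul_of_nonneg_right h1 (Real.exp_pos _).le).trans ?_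
      rw [← Real.exp_add]
      exact (Real.exp_le_exp.2 (by rw [hl]; ring_nf; rfl))
    · refine (mul_le_mul_of_nonneg_right h2 (Real.exp_pos _).le).trans ?_
      rw [← Real.exp_add]
      exact (Real.exp_le_exp.2 (by rw [hl]; ring_nf; rfl))
  have htotal : ∑ S ∈ (Finset.univ : Finset V).powerset, μ S * ∑ t ∈ I, bad t S < 1 := by
    simp_rw [Finset.mul_sum]
    rw [Finset.sum_comm]
    refine (Finset.sum_le_sum hbadsum).trans_lt ?_
    simpa using hsmall
  obtain ⟨S, -, hS⟩ : ∃ S ∈ (Finset.univ : Finset V).powerset, ∑ t ∈ I, bad t S < 1 := by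
    by_contra! hcon
    have : ∑ S ∈ (Finset.univ : Finset V).powerset, μ S * 1 ≤
        ∑ S ∈ (Finset.univ : Finset V).powerset, μ S * ∑ t ∈ I, bad t S :=
      Finset.sum_le_sum fun S hS => mul_le_mul_of_nonneg_left (hcon S hS) (hμ0 S)
    simp only [mul_one, hμ1] at this
    linarith
  refine ⟨S, fun t ht => ?_⟩
  have hbt : bad t S < 1 := lt_of_le_of_lt (Finset.single_le_sum (f := fun t => bad t S)
    (fun t _ => add_nonneg (Real.exp_pos _).le (Real.exp_pos _).le) ht) hS
  have hlpos : 0 < l := by positivity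
  rw [hbad] at hbt
  simp only at hbt
  constructor
  · have h : Real.exp (-l * ∑ u ∈ S, f t u + l * ((1 - γ) * R)) < 1 :=
      lt_of_le_of_lt (le_add_of_nonneg_left (Real.exp_pos _).le) hbt
    rw [Real.exp_lt_one_iff] at h
    nlinarith
  · have h : Real.exp (l * ∑ u ∈ S, f t u - l * ((1 + γ) * R)) < 1 :=
      lt_of_le_of_lt (le_add_of_nonneg_right (Real.exp_pos _).le) hbt
    rw [Real.exp_lt_one_iff] at h
    nlinarith

/-! ### Weights between vertex sets. -/

/-- The total weight between two vertex sets, counting ordered pairs. -/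
def pairWeight {V : Type*} (w : V → V → ℝ) (X Y : Finset V) : ℝ := ∑ u ∈ X, ∑ v ∈ Y, w u v

section PairWeight

variable {V : Type*} {w : V → V → ℝ}

theorem pairWeight_comm (hw : ∀ u v, w u v = w v u) (X Y : Finset V) :
    pairWeight w X Y = pairWeight w Y X := by
  unfold pairWeight
  rw [Finset.sum_comm]
  exact Finset.sum_congr rfl fun u _ => Finset.sum_congr rfl fun v _ => hw v u

theorem pairWeight_nonneg (h0 : ∀ u v, 0 ≤ w u v) (X Y : Finset V) : 0 ≤ pairWeight w X Y :=
  Finset.sum_nonneg fun u _ => Finset.sum_nonneg fun v _ => h0 u v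

theorem pairWeight_sdiff_left [DecidableEq V] {X' X : Finset V} (h : X' ⊆ X) (Y : Finset V) :
    pairWeight w X Y = pairWeight w X' Y + pairWeight w (X \ X') Y := by
  unfold pairWeight
  rw [add_comm, Finset.sum_sdiff h]

theorem pairWeight_sdiff_right [DecidableEq V] {Y' Y : Finset V} (h : Y' ⊆ Y) (X : Finset V) :
    pairWeight w X Y = pairWeight w X Y' + pairWeight w X (Y \ Y') := by
  unfold pairWeight
  rw [← Finset.sum_add_distrib]
  exact Finset.sum_congr rfl fun u _ => by rw [add_comm, Finset.sum_sdiff h]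

theorem pairWeight_mono_left [DecidableEq V] (h0 : ∀ u v, 0 ≤ w u v) {X' X : Finset V} (h : X' ⊆ X)
    (Y : Finset V) : pairWeight w X' Y ≤ pairWeight w X Y := by
  rw [pairWeight_sdiff_left h]
  linarith [pairWeight_nonneg h0 (X \ X') Y]

theorem pairWeight_mono_right [DecidableEq V] (h0 : ∀ u v, 0 ≤ w u v) {Y' Y : Finset V} (h : Y' ⊆ Y)
    (X : Finset V) : pairWeight w X Y' ≤ pairWeight w X Y := by
  rw [pairWeight_sdiff_right h]
  linarith [pairWeight_nonneg h0 X (Y \ Y')]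

theorem pairWeight_le_mul_card {X Y : Finset V} {c : ℝ} (h : ∀ v ∈ X, ∑ u ∈ Y, w v u ≤ c) :
    pairWeight w X Y ≤ c * X.card := by
  have := Finset.sum_le_card_nsmul X (fun v => ∑ u ∈ Y, w v u) c h
  rw [nsmul_eq_mul] at this
  unfold pairWeight
  linarith

theorem mul_card_le_pairWeight {X Y : Finset V} {c : ℝ} (h : ∀ v ∈ X, c ≤ ∑ u ∈ Y, w v u) :
    c * X.card ≤ pairWeight w X Y := by
  have := Finset.card_nsmul_le_sum X (fun v => ∑ u ∈ Y, w v u) c h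
  rw [nsmul_eq_mul] at this
  unfold pairWeight
  linarith

theorem pairWeight_self_sdiff [DecidableEq V] (hw : ∀ u v, w u v = w v u) {X' X : Finset V} (h : X' ⊆ X) :
    pairWeight w X X = pairWeight w X' X' + 2 * pairWeight w (X \ X') X
      - pairWeight w (X \ X') (X \ X') := by
  have h1 := pairWeight_sdiff_left (w := w) h X
  have h2 := pairWeight_sdiff_right (w := w) h X'
  have h3 := pairWeight_sdiff_right (w := w) h (X \ X')
  have h4 := pairWeight_comm hw X' (X \ X')
  linarith

theorem pairWeight_eq_zero_of_same_side {P X Y : Finset V}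
    (hbip : ∀ u v, w u v ≠ 0 → (u ∈ P ↔ v ∉ P))
    (h : ∀ u ∈ X, ∀ v ∈ Y, (u ∈ P ↔ v ∈ P)) : pairWeight w X Y = 0 := by
  refine Finset.sum_eq_zero fun u hu => Finset.sum_eq_zero fun v hv => ?_
  by_contra hne
  have := hbip u v hne
  have := h u hu v hv
  tauto

end PairWeight

/-! ### Cuts, boundaries and the Ore–Ryser condition. -/

/-- If every cut of a balanced bipartite weighted graph dominates the degree deficit of one of its
sides, then the graph satisfies the Ore–Ryser condition. -/
theorem hall_of_cut_ge_deficit {V : Type*} [DecidableEq V] {w : V → V → ℝ}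
    (hw : ∀ u v, w u v = w v u) {P U : Finset V}
    (hbip : ∀ u v, w u v ≠ 0 → (u ∈ P ↔ v ∉ P))
    (hbal : (U ∩ P).card = (U \ P).card) {c : ℝ}
    (hdeg : ∀ v ∈ U, ∑ u ∈ U, w v u ≤ c)
    (hcut : ∀ W ⊆ U, c * W.card - pairWeight w W U ≤ pairWeight w W (U \ W) ∨
      c * (U \ W).card - pairWeight w (U \ W) U ≤ pairWeight w W (U \ W))
    {X Z : Finset V} (hX : X ⊆ U ∩ P) (hZ : Z ⊆ U \ P) :
    c / 2 * ((X.card : ℝ) - Z.card) ≤ pairWeight w X ((U \ P) \ Z) := by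
  set A := U ∩ P with hA
  set B := U \ P with hB
  have hAU : A ⊆ U := Finset.inter_subset_left
  have hBU : B ⊆ U := Finset.sdiff_subset
  have hUA : U \ A = B := by ext x; simp [hA, hB]
  have zA : ∀ X₁ ⊆ A, ∀ X₂ ⊆ A, pairWeight w X₁ X₂ = 0 := fun X₁ h₁ X₂ h₂ =>
    pairWeight_eq_zero_of_same_side hbip fun u hu v hv =>
      iff_of_true (Finset.mem_inter.1 (h₁ hu)).2 (Finset.mem_inter.1 (h₂ hv)).2
  have zB : ∀ X₁ ⊆ B, ∀ X₂ ⊆ B, pairWeight w X₁ X₂ = 0 := fun X₁ h₁ X₂ h₂ =>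
    pairWeight_eq_zero_of_same_side hbip fun u hu v hv =>
      iff_of_false (Finset.mem_sdiff.1 (h₁ hu)).2 (Finset.mem_sdiff.1 (h₂ hv)).2
  set X' := A \ X with hX'
  set Z' := B \ Z with hZ'
  have hX'A : X' ⊆ A := Finset.sdiff_subset
  have hZ'B : Z' ⊆ B := Finset.sdiff_subset
  set W := X ∪ Z with hW
  have hWU : W ⊆ U := Finset.union_subset (hX.trans hAU) (hZ.trans hBU)
  have hWc : U \ W = X' ∪ Z' := by
    ext x
    simp only [hW, hX', hZ', hA, hB, Finset.mem_sdiff, Finset.mem_union, Finset.mem_inter]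
    have h1 : x ∈ X → x ∈ P := fun h => (Finset.mem_inter.1 (hX h)).2
    have h2 : x ∈ Z → x ∉ P := fun h => (Finset.mem_sdiff.1 (hZ h)).2
    tauto
  have hdXZ : Disjoint X Z := Finset.disjoint_left.2 fun x h1 h2 =>
    (Finset.mem_sdiff.1 (hZ h2)).2 (Finset.mem_inter.1 (hX h1)).2
  have hdXZ' : Disjoint X' Z' := Finset.disjoint_left.2 fun x h1 h2 =>
    (Finset.mem_sdiff.1 (hZ'B h2)).2 (Finset.mem_inter.1 (hX'A h1)).2
  have wtU : ∀ Y₁ Y₂ Y : Finset V, Disjoint Y₁ Y₂ →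
      pairWeight w (Y₁ ∪ Y₂) Y = pairWeight w Y₁ Y + pairWeight w Y₂ Y := fun Y₁ Y₂ Y h =>
    Finset.sum_union h
  have wtU' : ∀ Y₁ Y₂ Y : Finset V, Disjoint Y₁ Y₂ →
      pairWeight w Y (Y₁ ∪ Y₂) = pairWeight w Y Y₁ + pairWeight w Y Y₂ := fun Y₁ Y₂ Y h => by
    rw [pairWeight_comm hw, wtU _ _ _ h, pairWeight_comm hw Y₁, pairWeight_comm hw Y₂]
  have hUW : U = (X ∪ Z) ∪ (X' ∪ Z') := by rw [← hWc, ← hW, Finset.union_sdiff_of_subset hWU]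
  have hdW : Disjoint (X ∪ Z) (X' ∪ Z') := by rw [← hWc]; exact Finset.disjoint_sdiff
  have toU : ∀ Y, pairWeight w Y U = pairWeight w Y X + pairWeight w Y Z + pairWeight w Y X' +
      pairWeight w Y Z' := by
    intro Y
    conv_lhs => rw [hUW]
    rw [wtU' _ _ _ hdW, wtU' _ _ _ hdXZ, wtU' _ _ _ hdXZ']
    ring
  have hcard : (X.card : ℝ) + X'.card = Z.card + Z'.card := by
    have h1 : X'.card + X.card = A.card := Finset.card_sdiff_add_card_eq_card hX
    have h2 : Z'.card + Z.card = B.card := Finset.card_sdiff_add_card_eq_card hZ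
    have : X.card + X'.card = Z.card + Z'.card := by omega
    exact_mod_cast this
  have hcutval : pairWeight w W (U \ W) = pairWeight w X Z' + pairWeight w Z X' := by
    rw [hWc, hW, wtU _ _ _ hdXZ, wtU' _ _ _ hdXZ', wtU' _ _ _ hdXZ', zA X hX X' hX'A,
      zB Z hZ Z' hZ'B]
    ring
  have eX : pairWeight w X U = pairWeight w X Z + pairWeight w X Z' := by
    rw [toU, zA X hX X hX, zA X hX X' hX'A]; ring
  have eZ : pairWeight w Z U = pairWeight w Z X + pairWeight w Z X' := by
    rw [toU, zB Z hZ Z hZ, zB Z hZ Z' hZ'B]; ring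
  have eX' : pairWeight w X' U = pairWeight w X' Z + pairWeight w X' Z' := by
    rw [toU, zA X' hX'A X hX, zA X' hX'A X' hX'A]; ring
  have eZ' : pairWeight w Z' U = pairWeight w Z' X + pairWeight w Z' X' := by
    rw [toU, zB Z' hZ'B Z hZ, zB Z' hZ'B Z' hZ'B]; ring
  have dZ : pairWeight w Z U ≤ c * Z.card :=
    pairWeight_le_mul_card fun v hv => hdeg v (hBU (hZ hv))
  have dX' : pairWeight w X' U ≤ c * X'.card :=
    pairWeight_le_mul_card fun v hv => hdeg v (hAU (hX'A hv))
  have c1 := pairWeight_comm hw X Z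
  have c2 := pairWeight_comm hw X' Z'
  have c3 := pairWeight_comm hw X Z'
  have c4 := pairWeight_comm hw X' Z
  -- In the first case the cut bound reads c (|X| + |Z|) ≤ 2 w(X,Z') + 2 w(Z,U), and w(Z,U) ≤ c |Z|.
  -- The second case is the same for `X'` and `Z'`, with |Z'| - |X'| = |X| - |Z| by balance.
  rcases hcut W hWU with h | h
  · rw [hcutval, hW, Finset.card_union_of_disjoint hdXZ, wtU _ _ _ hdXZ] at h
    push_cast at h
    linarith
  · rw [hcutval, hWc, Finset.card_union_of_disjoint hdXZ', wtU _ _ _ hdXZ'] at h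
    push_cast at h
    have : c * ((X.card : ℝ) - Z.card) = c * Z'.card - c * X'.card := by
      rw [← mul_sub]; congr 1; linarith
    linarith

/-- In a nearly regular weighted bipartite graph, a set of small boundary is nearly balanced. -/
theorem card_sub_card_le_of_boundary {V : Type*} [DecidableEq V] {w : V → V → ℝ}
    (hw : ∀ u v, w u v = w v u) (h0 : ∀ u v, 0 ≤ w u v) {S A B : Finset V} (hd : Disjoint A B)
    (hS : A ∪ B ⊆ S) (hA : pairWeight w A A = 0) {R γ Ψ : ℝ}
    (hlow : ∀ v ∈ S, (1 - γ) * R ≤ ∑ u ∈ S, w v u) (hup : ∀ v ∈ S, ∑ u ∈ S, w v u ≤ (1 + γ) * R)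
    (hΨ : pairWeight w (A ∪ B) (S \ (A ∪ B)) ≤ Ψ) (hγ : γ * R * (A ∪ B).card ≤ Ψ) :
    R * ((A.card : ℝ) - B.card) ≤ 2 * Ψ := by
  have hAS := (Finset.subset_union_left (s₁ := A) (s₂ := B)).trans hS
  have hBS := (Finset.subset_union_right (s₁ := A) (s₂ := B)).trans hS
  -- All weight leaving `A` goes to `B` or across the boundary, so (1 - γ) R |A| ≤ (1 + γ) R |B| +
  -- Ψ; the `γ` terms cost at most another `Ψ`.
  have h1 : (1 - γ) * R * A.card ≤ pairWeight w A S :=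
    mul_card_le_pairWeight fun v hv => hlow v (hAS hv)
  have h2 : pairWeight w B S ≤ (1 + γ) * R * B.card :=
    pairWeight_le_mul_card fun v hv => hup v (hBS hv)
  have h3 := pairWeight_sdiff_right (w := w) hS A
  have h4 : pairWeight w A (A ∪ B) = pairWeight w A A + pairWeight w A B := by
    unfold pairWeight
    rw [← Finset.sum_add_distrib]
    exact Finset.sum_congr rfl fun u _ => Finset.sum_union hd
  have h5 := pairWeight_comm hw A B
  have h6 := pairWeight_mono_right h0 hAS B
  have h7 := pairWeight_mono_left h0 (Finset.subset_union_left (s₁ := A) (s₂ := B))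
    (S \ (A ∪ B))
  rw [Finset.card_union_of_disjoint hd] at hγ
  push_cast at hγ
  linarith

/-- Trim the larger side. The natural subtractions are truncated, hence one disjunct for each
possible larger side. -/
theorem exists_balanced_subset {V : Type*} [DecidableEq V] (P U : Finset V) :
    ∃ U' ⊆ U, (U' ∩ P).card = (U' \ P).card ∧
      ((U \ U').card = (U ∩ P).card - (U \ P).card ∨
        (U \ U').card = (U \ P).card - (U ∩ P).card) := by
  rcases le_total (U \ P).card (U ∩ P).card with h | h
  · obtain ⟨T, hT, hTc⟩ := Finset.exists_subset_card_eq (Nat.sub_le (U ∩ P).card (U \ P).card)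
    have hTU : T ⊆ U := hT.trans Finset.inter_subset_left
    refine ⟨U \ T, Finset.sdiff_subset, ?_, Or.inl ?_⟩
    · have e1 : (U \ T) ∩ P = (U ∩ P) \ T := by ext x; simp only [Finset.mem_inter, Finset.mem_sdiff]; tauto
      have e2 : (U \ T) \ P = U \ P := by
        ext x
        have : x ∈ T → x ∈ P := fun hx => (Finset.mem_inter.1 (hT hx)).2
        simp only [Finset.mem_sdiff]; tauto
      have := Finset.card_sdiff_add_card_eq_card hT
      rw [e1, e2]
      omega
    · rw [Finset.sdiff_sdiff_eq_self hTU, hTc]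
  · obtain ⟨T, hT, hTc⟩ := Finset.exists_subset_card_eq (Nat.sub_le (U \ P).card (U ∩ P).card)
    have hTU : T ⊆ U := hT.trans Finset.sdiff_subset
    refine ⟨U \ T, Finset.sdiff_subset, ?_, Or.inr ?_⟩
    · have e1 : (U \ T) \ P = (U \ P) \ T := by ext x; simp only [Finset.mem_sdiff]; tauto
      have e2 : (U \ T) ∩ P = U ∩ P := by
        ext x
        have : x ∈ T → x ∉ P := fun hx => (Finset.mem_sdiff.1 (hT hx)).2
        simp only [Finset.mem_sdiff, Finset.mem_inter]; tauto
      have := Finset.card_sdiff_add_card_eq_card hT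
      rw [e1, e2]
      omega
    · rw [Finset.sdiff_sdiff_eq_self hTU, hTc]

/-- There is a set all of whose large cuts are far heavier than its boundary. -/
theorem exists_large_cuts_of_small_boundary {V : Type*} [DecidableEq V] {w : V → V → ℝ}
    (hw : ∀ u v, w u v = w v u) (h0 : ∀ u v, 0 ≤ w u v)
    {S : Finset V} {s m b M : ℝ} {L : ℕ} (hs : 0 < s) (hsL : s * L = m) (hsS : s ≤ S.card)
    (hSm : (S.card : ℝ) ≤ m) (hb : 0 ≤ b) (hM : 1 ≤ M) :
    ∃ U ⊆ S, ∃ Ψ, s ≤ U.card ∧ pairWeight w U (S \ U) ≤ Ψ ∧ b ≤ Ψ ∧ Ψ ≤ b * M ^ L ∧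
      ∀ W ⊆ U, s ≤ W.card → s ≤ (U \ W).card → (M - 1) * Ψ ≤ pairWeight w W (U \ W) := by
  -- State after `i` rounds of removing one side of a light cut: a round costs at least `s` vertices
  -- and multiplies the boundary bound by at most `M`. Since s L = m, there are at most `L` rounds.
  let Q : ℕ → Prop := fun i => ∃ U ⊆ S, s ≤ U.card ∧ (U.card : ℝ) + i * s ≤ m ∧
    pairWeight w U (S \ U) ≤ b * M ^ i
  have hQ0 : Q 0 := ⟨S, subset_rfl, hsS, by simpa using hSm, by simpa [pairWeight] using hb⟩
  have hQL : ∀ i, Q i → i ≤ L := by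
    rintro i ⟨U, -, hU, hi, -⟩
    have : (i : ℝ) * s ≤ L * s := by linarith
    exact_mod_cast le_of_mul_le_mul_right this hs
  obtain ⟨i, ⟨U, hUS, hU, hi, hbd⟩, hnot⟩ : ∃ i, Q i ∧ ¬ Q (i + 1) := by
    by_contra! hcon
    have hall : ∀ i, Q i := fun i => Nat.rec hQ0 (fun i hi => hcon i hi) i
    have := hQL _ (hall (L + 1))
    omega
  have hiL : i ≤ L := hQL i ⟨U, hUS, hU, hi, hbd⟩
  refine ⟨U, hUS, b * M ^ i, hU, hbd, le_mul_of_one_le_right hb (one_le_pow₀ hM),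
    mul_le_mul_of_nonneg_left (pow_le_pow_right₀ hM hiL) hb, fun W hW hWs hWs' => ?_⟩
  by_contra! hlt
  apply hnot
  refine ⟨U \ W, Finset.sdiff_subset.trans hUS, hWs', ?_, ?_⟩
  · have : ((U \ W).card : ℝ) + W.card = U.card := by
      exact_mod_cast Finset.card_sdiff_add_card_eq_card hW
    push_cast
    linarith
  · have hsub : S \ U ⊆ S \ (U \ W) := Finset.sdiff_subset_sdiff subset_rfl Finset.sdiff_subset
    have h1 := pairWeight_sdiff_right (w := w) hsub (U \ W)
    have h2 : (S \ (U \ W)) \ (S \ U) = W := by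
      ext x
      have := @hW x
      have := @hUS x
      simp only [Finset.mem_sdiff]
      tauto
    rw [h2, pairWeight_comm hw _ W] at h1
    have h3 := pairWeight_mono_left h0 (Finset.sdiff_subset : U \ W ⊆ U) (S \ U)
    rw [h1, pow_succ]
    linarith

/-! ### From near-regularity to a balanced Ore–Ryser subgraph. -/

set_option maxHeartbeats 1000000 in
/-- A nearly regular bipartite weighted graph with sparse small sets contains a balanced induced
subgraph satisfying the Ore–Ryser condition. -/
theorem exists_balanced_hall {V : Type*} [DecidableEq V] {w : V → V → ℝ}
    (hw : ∀ u v, w u v = w v u) (h0 : ∀ u v, 0 ≤ w u v) {P S : Finset V}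
    (hbip : ∀ u v, w u v ≠ 0 → (u ∈ P ↔ v ∉ P)) (hS : S.Nonempty) {m L : ℕ} (hL : 1 ≤ L)
    (hm : 4 * L ≤ m) (hSm : S.card ≤ m) {R γ : ℝ} (hR : 0 < R) (hγ : γ = 1 / (320 * L * 1000 ^ L))
    (hlow : ∀ v ∈ S, (1 - γ) * R ≤ ∑ u ∈ S, w v u) (hup : ∀ v ∈ S, ∑ u ∈ S, w v u ≤ (1 + γ) * R)
    (hsmall : ∀ W ⊆ S, (L : ℝ) * W.card ≤ m → pairWeight w W W ≤ R / 8 * W.card) :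
    ∃ U ⊆ S, U.Nonempty ∧ (U ∩ P).card = (U \ P).card ∧
      ∀ X ⊆ U ∩ P, ∀ Z ⊆ U \ P,
        R / 2 * ((X.card : ℝ) - Z.card) ≤ pairWeight w X ((U \ P) \ Z) := by
  have hLr : (1 : ℝ) ≤ L := by exact_mod_cast hL
  have hmr : 4 * (L : ℝ) ≤ m := by exact_mod_cast hm
  have hpow : (1 : ℝ) ≤ 1000 ^ L := one_le_pow₀ (by norm_num)
  have hγ0 : 0 < γ := by rw [hγ]; positivity
  have hγ1 : γ ≤ 1 / 320 := by
    rw [hγ]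
    apply one_div_le_one_div_of_le (by norm_num)
    nlinarith
  set s : ℝ := m / L with hs
  have hsL : s * L = m := by rw [hs]; field_simp
  have hs4 : 4 ≤ s := by rw [hs, le_div_iff₀ (by linarith)]; exact hmr
  have hsmall' : ∀ W ⊆ S, (W.card : ℝ) ≤ s → pairWeight w W W ≤ R / 8 * W.card := by
    intro W hW h
    apply hsmall W hW
    rw [hs, le_div_iff₀ (by linarith)] at h
    linarith
  have hsS : s ≤ S.card := by
    by_contra! hlt
    have h1 := hsmall' S subset_rfl hlt.le
    have h2 : (1 - γ) * R * S.card ≤ pairWeight w S S := mul_card_le_pairWeight hlow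
    have h3 : (0 : ℝ) < S.card := by exact_mod_cast hS.card_pos
    have h4 : 0 < R * S.card := mul_pos hR h3
    nlinarith
  obtain ⟨U, hUS, Ψ, hUs, hbd, hΨb, hΨM, hcuts⟩ := exists_large_cuts_of_small_boundary hw h0
    (b := γ * R * m) (M := 1000) (by linarith) hsL hsS (by exact_mod_cast hSm) (by positivity)
    (by norm_num)
  -- The choice of `γ` makes even the boundary bound after `L` rounds, γ R m 1000^L, equal to R s /
  -- 320.
  have hΨs : 320 * Ψ ≤ R * s := by
    have : γ * R * m * 1000 ^ L = R * s / 320 := by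
      rw [hγ, hs]; field_simp
    linarith
  have hΨ0 : 0 ≤ Ψ := le_trans (by positivity) hΨb
  have hcardm : ∀ W ⊆ S, γ * R * W.card ≤ Ψ := by
    intro W hW
    refine le_trans (mul_le_mul_of_nonneg_left ?_ (by positivity)) hΨb
    exact_mod_cast (Finset.card_le_card hW).trans hSm
  -- a balanced subset of `U` obtained by removing few vertices
  obtain ⟨U₀, hU₀, hU₀bal, hU₀c⟩ := exists_balanced_subset P U
  have hside : U ∩ P ∪ U \ P = U := by ext x; simp only [Finset.mem_union, Finset.mem_inter, Finset.mem_sdiff]; tauto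
  have hside' : U \ P ∪ U ∩ P = U := by rw [Finset.union_comm, hside]
  have hdside : Disjoint (U ∩ P) (U \ P) := Finset.disjoint_left.2 fun x h1 h2 =>
    (Finset.mem_sdiff.1 h2).2 (Finset.mem_inter.1 h1).2
  have hU₀R : R * (U \ U₀).card ≤ 2 * Ψ := by
    rcases hU₀c with h | h
    · rw [h]
      rcases le_total (U \ P).card (U ∩ P).card with h' | h'
      · rw [Nat.cast_sub h']
        refine card_sub_card_le_of_boundary hw h0 hdside (by rwa [hside]) ?_ hlow hup
          (by rwa [hside]) (by rw [hside]; exact hcardm U hUS)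
        exact pairWeight_eq_zero_of_same_side hbip fun u hu v hv =>
          iff_of_true (Finset.mem_inter.1 hu).2 (Finset.mem_inter.1 hv).2
      · rw [Nat.sub_eq_zero_of_le h']; simpa using hΨ0
    · rw [h]
      rcases le_total (U ∩ P).card (U \ P).card with h' | h'
      · rw [Nat.cast_sub h']
        refine card_sub_card_le_of_boundary hw h0 hdside.symm (by rwa [hside']) ?_ hlow hup
          (by rwa [hside']) (by rw [hside']; exact hcardm U hUS)
        exact pairWeight_eq_zero_of_same_side hbip fun u hu v hv =>
          iff_of_false (Finset.mem_sdiff.1 hu).2 (Finset.mem_sdiff.1 hv).2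
      · rw [Nat.sub_eq_zero_of_le h']; simpa using hΨ0
  have hupU : ∀ W ⊆ S, ∀ Y ⊆ S, pairWeight w W Y ≤ (1 + γ) * R * W.card := fun W hW Y hY =>
    (pairWeight_mono_right h0 hY W).trans (pairWeight_le_mul_card fun v hv => hup v (hW hv))
  -- the balanced subset optimising density against size
  let Φ : Finset V → ℝ := fun X => pairWeight w X X - 7 / 4 * R * X.card
  obtain ⟨U', hU'mem, hU'max⟩ := Finset.exists_max_image
    (U.powerset.filter fun X => (X ∩ P).card = (X \ P).card ∧ ((U \ X).card : ℝ) ≤ s) Φ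
    ⟨U₀, by
      rw [Finset.mem_filter, Finset.mem_powerset]
      refine ⟨hU₀, hU₀bal, ?_⟩
      have : R * (U \ U₀).card ≤ R * s := by linarith
      exact le_of_mul_le_mul_left this hR⟩
  rw [Finset.mem_filter, Finset.mem_powerset] at hU'mem
  obtain ⟨hU'U, hbal, hQs⟩ := hU'mem
  set Q := U \ U' with hQ
  have hQU : Q ⊆ U := Finset.sdiff_subset
  have hQS := hQU.trans hUS
  have hU'S := hU'U.trans hUS
  have cardQ : (Q.card : ℝ) + U'.card = U.card := by
    exact_mod_cast Finset.card_sdiff_add_card_eq_card hU'U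
  -- Deleting `Q` lowers `Φ` by at least (1/8 - 2γ) R |Q| - 2Ψ: its vertices have degree about `R`
  -- and `Q` is sparse inside, so about 15/8 R of weight is lost per vertex against a gain of 7/4 R.
  -- The competitor `U₀` loses only O(Ψ).
  have hQR : R * Q.card ≤ 160 * Ψ := by
    have hmax : Φ U₀ ≤ Φ U' := hU'max U₀ (by
      rw [Finset.mem_filter, Finset.mem_powerset]
      refine ⟨hU₀, hU₀bal, ?_⟩
      have : R * (U \ U₀).card ≤ R * s := by linarith
      exact le_of_mul_le_mul_left this hR)
    simp only [Φ] at hmax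
    have e1 := pairWeight_self_sdiff hw hU₀
    have e2 := pairWeight_self_sdiff hw hU'U
    rw [← hQ] at e2
    have e3 := pairWeight_nonneg h0 (U \ U₀) (U \ U₀)
    have e4 := hupU (U \ U₀) (Finset.sdiff_subset.trans hUS) U hUS
    have e5 := hsmall' Q hQS hQs
    have e6 : (1 - γ) * R * Q.card ≤ pairWeight w Q S :=
      mul_card_le_pairWeight fun v hv => hlow v (hQS hv)
    have e7 := pairWeight_sdiff_right (w := w) hUS Q
    have e8 := pairWeight_mono_left h0 hQU (S \ U)
    have e9 : (U₀.card : ℝ) ≤ U.card := by exact_mod_cast Finset.card_le_card hU₀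
    have e10 : R * U₀.card ≤ R * U.card := mul_le_mul_of_nonneg_left e9 hR.le
    have e11 : γ * (R * (U \ U₀).card) ≤ 1 * (R * (U \ U₀).card) :=
      mul_le_mul_of_nonneg_right (by linarith) (by positivity)
    have e12 : γ * (R * Q.card) ≤ 1 / 320 * (R * Q.card) :=
      mul_le_mul_of_nonneg_right (by linarith) (by positivity)
    have e13 : R * Q.card + R * U'.card = R * U.card := by rw [← mul_add, cardQ]
    linarith
  -- Leaves room to delete one more pair from `U'` while staying among the sets over which `Φ` was
  -- maximised.
  have hQs2 : (Q.card : ℝ) + 2 ≤ s := by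
    have : R * Q.card ≤ R * (s / 2) := by linarith
    have := le_of_mul_le_mul_left this hR
    linarith
  have hU'ne : U'.Nonempty := by
    rw [Finset.nonempty_iff_ne_empty]
    rintro h
    rw [h] at cardQ
    simp only [Finset.card_empty, Nat.cast_zero, add_zero] at cardQ
    linarith
  have hdegU' : ∀ v ∈ U', ∑ u ∈ U', w v u ≤ (1 + γ) * R := fun v hv =>
    (Finset.sum_le_sum_of_subset_of_nonneg hU'S fun u _ _ => h0 v u).trans (hup v (hU'S hv))
  have hpair : ∀ a ∈ U' ∩ P, ∀ b ∈ U' \ P,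
      7 / 4 * R * 2 ≤ 2 * (∑ u ∈ U', w a u + ∑ u ∈ U', w b u) := by
    intro a ha b hb
    have haU := (Finset.mem_inter.1 ha).1
    have haP := (Finset.mem_inter.1 ha).2
    have hbU := (Finset.mem_sdiff.1 hb).1
    have hbP := (Finset.mem_sdiff.1 hb).2
    have hab : a ≠ b := fun h => hbP (h ▸ haP)
    have hsub : ({a, b} : Finset V) ⊆ U' := by
      intro x hx
      rcases Finset.mem_insert.1 hx with rfl | hx
      · exact haU
      · rwa [Finset.mem_singleton.1 hx]
    have hcab : ({a, b} : Finset V).card = 2 := Finset.card_pair hab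
    have hmax : Φ (U' \ {a, b}) ≤ Φ U' := hU'max _ (by
      rw [Finset.mem_filter, Finset.mem_powerset]
      refine ⟨Finset.sdiff_subset.trans hU'U, ?_, ?_⟩
      · have e1 : (U' \ {a, b}) ∩ P = (U' ∩ P).erase a := by
          ext x
          simp only [Finset.mem_inter, Finset.mem_sdiff, Finset.mem_insert, Finset.mem_singleton,
            Finset.mem_erase]
          constructor
          · rintro ⟨⟨h1, h2⟩, h3⟩; exact ⟨fun h => h2 (Or.inl h), h1, h3⟩
          · rintro ⟨h1, h2, h3⟩
            exact ⟨⟨h2, fun h => h.elim h1 fun h => hbP (h ▸ h3)⟩, h3⟩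
        have e2 : (U' \ {a, b}) \ P = (U' \ P).erase b := by
          ext x
          simp only [Finset.mem_sdiff, Finset.mem_insert, Finset.mem_singleton,
            Finset.mem_erase]
          constructor
          · rintro ⟨⟨h1, h2⟩, h3⟩; exact ⟨fun h => h2 (Or.inr h), h1, h3⟩
          · rintro ⟨h1, h2, h3⟩
            exact ⟨⟨h2, fun h => h.elim (fun h => h3 (h ▸ haP)) h1⟩, h3⟩
        rw [e1, e2, Finset.card_erase_of_mem ha, Finset.card_erase_of_mem hb, hbal]
      · have e3 : U \ (U' \ {a, b}) ⊆ Q ∪ {a, b} := by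
          intro x
          simp only [hQ, Finset.mem_sdiff, Finset.mem_union]
          tauto
        have e4 := (Finset.card_le_card e3).trans (Finset.card_union_le _ _)
        rw [hcab] at e4
        have e5 : ((U \ (U' \ {a, b})).card : ℝ) ≤ Q.card + 2 := by exact_mod_cast e4
        linarith)
    simp only [Φ] at hmax
    have e1 := pairWeight_self_sdiff hw (Finset.sdiff_subset : U' \ {a, b} ⊆ U')
    rw [Finset.sdiff_sdiff_eq_self hsub] at e1
    have e2 := pairWeight_nonneg h0 {a, b} {a, b}
    have e3 : pairWeight w {a, b} U' = ∑ u ∈ U', w a u + ∑ u ∈ U', w b u := Finset.sum_pair hab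
    have e4 : ((U' \ {a, b}).card : ℝ) + 2 = U'.card := by
      have := Finset.card_sdiff_add_card_eq_card hsub
      rw [hcab] at this
      exact_mod_cast this
    have e5 : R * (U' \ {a, b}).card + R * 2 = R * U'.card := by rw [← mul_add, e4]
    linarith
  have hγR : γ * R ≤ 1 / 320 * R := mul_le_mul_of_nonneg_right hγ1 hR.le
  -- Opposite vertices have degree sum at least 7/4 R by `hpair`, and neither degree exceeds (1 + γ)
  -- R.
  have hmindeg : ∀ v ∈ U', 5 / 8 * R ≤ ∑ u ∈ U', w v u := by
    have hcardsum : (U' ∩ P).card + (U' \ P).card = U'.card := Finset.card_inter_add_card_sdiff _ _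
    have hpos := hU'ne.card_pos
    intro v hv
    by_cases hvP : v ∈ P
    · obtain ⟨b, hb⟩ : (U' \ P).Nonempty := Finset.card_pos.1 (by omega)
      have e1 := hpair v (Finset.mem_inter.2 ⟨hv, hvP⟩) b hb
      have e2 := hdegU' b (Finset.mem_sdiff.1 hb).1
      linarith
    · obtain ⟨a, ha⟩ : (U' ∩ P).Nonempty := Finset.card_pos.1 (by omega)
      have e1 := hpair a ha v (Finset.mem_sdiff.2 ⟨hv, hvP⟩)
      have e2 := hdegU' a (Finset.mem_inter.1 ha).1
      linarith
  have hQup : pairWeight w Q U' ≤ 320 * Ψ := by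
    have e1 := hupU Q hQS U' hU'S
    have e2 : γ * (R * Q.card) ≤ 1 / 320 * (R * Q.card) :=
      mul_le_mul_of_nonneg_right (by linarith) (by positivity)
    linarith
  -- the total deficit is small
  have hdef : (1 + γ) * R * U'.card - pairWeight w U' U' ≤ 323 * Ψ := by
    have e1 : (1 - γ) * R * U'.card ≤ pairWeight w U' S :=
      mul_card_le_pairWeight fun v hv => hlow v (hU'S hv)
    have e2 := pairWeight_sdiff_right (w := w) hUS U'
    have e3 := pairWeight_sdiff_right (w := w) hU'U U'
    rw [← hQ, pairWeight_comm hw U' Q] at e3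
    have e4 := pairWeight_mono_left h0 hU'U (S \ U)
    have e5 := hcardm U' hU'S
    linarith
  have hdefW : ∀ W ⊆ U', (1 + γ) * R * W.card - pairWeight w W U' ≤ 323 * Ψ := by
    intro W hW
    have e1 := pairWeight_sdiff_left (w := w) hW U'
    have e2 : pairWeight w (U' \ W) U' ≤ (1 + γ) * R * (U' \ W).card :=
      pairWeight_le_mul_card fun v hv => hdegU' v (Finset.sdiff_subset hv)
    have e3 : ((U' \ W).card : ℝ) + W.card = U'.card := by
      exact_mod_cast Finset.card_sdiff_add_card_eq_card hW
    have e4 : (1 + γ) * R * (U' \ W).card + (1 + γ) * R * W.card = (1 + γ) * R * U'.card := by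
      rw [← mul_add, e3]
    linarith
  -- The cut is at least (5/8 - 1/8) R |W|, while the deficit is at most (3/8 + γ) R |W|.
  have hsmallcut : ∀ W ⊆ U', (W.card : ℝ) ≤ s →
      (1 + γ) * R * W.card - pairWeight w W U' ≤ pairWeight w W (U' \ W) := by
    intro W hW hWs
    have e1 := hsmall' W (hW.trans hU'S) hWs
    have e2 := pairWeight_sdiff_right (w := w) hW W
    have e3 : 5 / 8 * R * W.card ≤ pairWeight w W U' :=
      mul_card_le_pairWeight fun v hv => hmindeg v (hW hv)
    have e4 : γ * R * W.card ≤ 1 / 320 * R * W.card :=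
      mul_le_mul_of_nonneg_right hγR (by positivity)
    have e5 : 0 ≤ R * W.card := by positivity
    linarith
  refine ⟨U', hU'S, hU'ne, hbal, fun X hX Z hZ => ?_⟩
  have hfin := hall_of_cut_ge_deficit hw hbip hbal hdegU' (fun W hW => ?_) hX hZ
  · rcases le_total (Z.card : ℝ) X.card with h | h
    · refine le_trans (mul_le_mul_of_nonneg_right ?_ (by linarith)) hfin
      have : 0 ≤ γ * R := by positivity
      linarith
    · refine le_trans ?_ (pairWeight_nonneg h0 _ _)
      exact mul_nonpos_of_nonneg_of_nonpos (by linarith) (by linarith)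
  · rcases le_or_gt (W.card : ℝ) s with h1 | h1
    · exact Or.inl (hsmallcut W hW h1)
    rcases le_or_gt ((U' \ W).card : ℝ) s with h2 | h2
    · right
      have := hsmallcut (U' \ W) Finset.sdiff_subset h2
      rwa [Finset.sdiff_sdiff_eq_self hW, pairWeight_comm hw (U' \ W) W] at this
    -- Both sides are large: the cut in `U` weighs at least 999 Ψ, passing to `U'` loses at most 320
    -- Ψ, and the deficit is at most 323 Ψ.
    left
    have hsub : U' \ W ⊆ U \ W := Finset.sdiff_subset_sdiff hU'U subset_rfl
    have e0 : ((U' \ W).card : ℝ) ≤ (U \ W).card := by exact_mod_cast Finset.card_le_card hsub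
    have e1 := hcuts W (hW.trans hU'U) h1.le (by linarith)
    have e2 := pairWeight_sdiff_right (w := w) hsub W
    have e3 : (U \ W) \ (U' \ W) = Q := by
      ext x
      have := @hW x
      simp only [hQ, Finset.mem_sdiff]
      tauto
    rw [e3] at e2
    have e4 := pairWeight_mono_left h0 hW Q
    rw [pairWeight_comm hw U' Q] at e4
    have e5 := hdefW W hW
    linarith

/-! ### Cuts, averaging and sets of extremal density. -/

/-- Every weighted graph has a cut carrying at least half of its weight. -/
theorem exists_cut_ge_half {V : Type*} [DecidableEq V] {w : V → V → ℝ}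
    (hw : ∀ u v, w u v = w v u) (hloop : ∀ v, w v v = 0) (W : Finset V) :
    ∃ P ⊆ W, pairWeight w W W ≤ 4 * pairWeight w P (W \ P) := by
  induction W using Finset.induction_on with
  | empty => exact ⟨∅, subset_rfl, by simp [pairWeight]⟩
  | insert v W hv ih =>
    obtain ⟨P, hP, hcut⟩ := ih
    have hvP : v ∉ P := fun h => hv (hP h)
    have hvW : v ∉ W \ P := fun h => hv (Finset.mem_sdiff.1 h).1
    have ins : ∀ X Y : Finset V, v ∉ X →
        pairWeight w (insert v X) Y = ∑ y ∈ Y, w v y + pairWeight w X Y :=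
      fun X Y h => Finset.sum_insert h
    have ins' : ∀ X Y : Finset V, v ∉ X →
        pairWeight w Y (insert v X) = ∑ y ∈ Y, w v y + pairWeight w Y X :=
      fun X Y h => by rw [pairWeight_comm hw, ins X Y h, pairWeight_comm hw]
    have e1 : pairWeight w (insert v W) (insert v W) =
        2 * ∑ y ∈ W, w v y + pairWeight w W W := by
      rw [ins W _ hv, ins' W W hv, Finset.sum_insert hv, hloop]; ring
    have e2 : ∑ y ∈ W, w v y = ∑ y ∈ P, w v y + ∑ y ∈ W \ P, w v y := by
      rw [add_comm, Finset.sum_sdiff hP]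
    rcases le_total (∑ y ∈ P, w v y) (∑ y ∈ W \ P, w v y) with h | h
    · refine ⟨insert v P, Finset.insert_subset_insert v hP, ?_⟩
      have e3 : insert v W \ insert v P = W \ P := by
        ext x
        simp only [Finset.mem_sdiff, Finset.mem_insert]
        by_cases hx : x = v
        · subst hx; simp [hv]
        · simp [hx]
      rw [e3, ins P _ hvP, e1]
      linarith
    · refine ⟨P, hP.trans (Finset.subset_insert _ _), ?_⟩
      have e3 : insert v W \ P = insert v (W \ P) := Finset.insert_sdiff_of_notMem _ hvP
      rw [e3, ins' (W \ P) P hvW, e1]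
      linarith

/-- Some `k`-subset has at least the average weight. -/
theorem exists_subset_card_eq_average_le {V : Type*} [DecidableEq V] (f : V → ℝ) (k : ℕ)
    (T : Finset V) (hk : k ≤ T.card) :
    ∃ Y ⊆ T, Y.card = k ∧ (k : ℝ) * ∑ v ∈ T, f v ≤ T.card * ∑ v ∈ Y, f v := by
  obtain ⟨n, hn⟩ := Nat.exists_eq_add_of_le hk
  induction n generalizing T with
  | zero => exact ⟨T, subset_rfl, by omega, by rw [show T.card = k by omega]⟩
  | succ n ih =>
    have hT : T.Nonempty := Finset.card_pos.1 (by omega)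
    obtain ⟨x, hx, hmin⟩ := Finset.exists_min_image T f hT
    have hc := Finset.card_erase_of_mem hx
    obtain ⟨Y, hY, hYk, hsum⟩ := ih (T.erase x) (by omega) (by omega)
    refine ⟨Y, hY.trans (Finset.erase_subset _ _), hYk, ?_⟩
    have e1 := Finset.add_sum_erase T f hx
    have e2 : (T.card : ℝ) * f x ≤ ∑ v ∈ T, f v := by
      rw [← nsmul_eq_mul]; exact Finset.card_nsmul_le_sum T f _ hmin
    have e4 : ((T.erase x).card : ℝ) = k + n := by exact_mod_cast (by omega : (T.erase x).card = k + n)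
    have e5 : (T.card : ℝ) = k + n + 1 := by exact_mod_cast (by omega : T.card = k + n + 1)
    rw [e4] at hsum
    rw [e5] at e2 ⊢
    have hk0 : (0 : ℝ) ≤ k := Nat.cast_nonneg k
    have hn0 : (0 : ℝ) ≤ n := Nat.cast_nonneg n
    rcases hk0.eq_or_lt with h0 | h0
    · have hk' : k = 0 := by exact_mod_cast h0.symm
      have : Y = ∅ := Finset.card_eq_zero.1 (hYk.trans hk')
      subst this
      simp [← h0]
    · have hpos : 0 < (k : ℝ) + n := by linarith
      have e6 : ((k : ℝ) + n) * ∑ v ∈ T, f v ≤ (k + n + 1) * ∑ v ∈ T.erase x, f v := by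
        nlinarith
      have e7 : ((k : ℝ) + n) * (k * ∑ v ∈ T, f v) ≤
          (k + n) * ((k + n + 1) * ∑ v ∈ Y, f v) := by
        calc ((k : ℝ) + n) * (k * ∑ v ∈ T, f v) = k * (((k : ℝ) + n) * ∑ v ∈ T, f v) := by ring
          _ ≤ k * ((k + n + 1) * ∑ v ∈ T.erase x, f v) := mul_le_mul_of_nonneg_left e6 hk0
          _ = (k + n + 1) * (k * ∑ v ∈ T.erase x, f v) := by ring
          _ ≤ (k + n + 1) * ((k + n) * ∑ v ∈ Y, f v) :=
            mul_le_mul_of_nonneg_left hsum (by linarith)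
          _ = _ := by ring
      exact le_of_mul_le_mul_left e7 hpos

/-- A vertex set of extremal density. -/
theorem exists_extremal_set {V : Type*} [Fintype V] [Nonempty V] (w : V → V → ℝ) {a : ℝ}
    (ha : 0 < a) :
    ∃ W₀ : Finset V, ∃ ρ : ℝ, W₀.Nonempty ∧ pairWeight w W₀ W₀ = ρ * (W₀.card : ℝ) ^ (1 + a) ∧
      (∀ W, pairWeight w W W ≤ ρ * (W.card : ℝ) ^ (1 + a)) ∧
      pairWeight w Finset.univ Finset.univ / (Fintype.card V : ℝ) ^ (1 + a) ≤ ρ := by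
  classical
  obtain ⟨W₀, hW₀, hmax⟩ := Finset.exists_max_image
    ((Finset.univ : Finset V).powerset.filter fun W => W.Nonempty)
    (fun W => pairWeight w W W / (W.card : ℝ) ^ (1 + a))
    ⟨Finset.univ, by simp⟩
  have hne : W₀.Nonempty := (Finset.mem_filter.1 hW₀).2
  have hpos : ∀ W : Finset V, W.Nonempty → 0 < (W.card : ℝ) ^ (1 + a) := fun W hW =>
    Real.rpow_pos_of_pos (by exact_mod_cast hW.card_pos) _
  refine ⟨W₀, pairWeight w W₀ W₀ / (W₀.card : ℝ) ^ (1 + a), hne, ?_, fun W => ?_, ?_⟩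
  · rw [div_mul_cancel₀ _ (hpos W₀ hne).ne']
  · rcases W.eq_empty_or_nonempty with rfl | hW
    · simp [pairWeight, Real.zero_rpow (by linarith : (1 + a) ≠ 0)]
    · have := hmax W (by simp [hW])
      rwa [div_le_iff₀ (hpos W hW)] at this
  · exact hmax Finset.univ (by simp)

/-- A set of extremal density contains an almost regular subset of comparable density. -/
theorem exists_almost_regular_subset {V : Type*} [DecidableEq V] {w : V → V → ℝ}
    (hw : ∀ u v, w u v = w v u) (h0 : ∀ u v, 0 ≤ w u v)
    {a : ℝ} (ha : 0 < a) {W₀ : Finset V} {ρ d : ℝ} (hne : W₀.Nonempty)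
    (hd : d = ρ * (W₀.card : ℝ) ^ a) (hd0 : 0 < d) (hW₀ : pairWeight w W₀ W₀ = d * W₀.card)
    (hsparse : ∀ W, pairWeight w W W ≤ ρ * (W.card : ℝ) ^ (1 + a))
    {K : ℝ} (hK : K = 2 * 32 ^ (1 / a)) :
    ∃ U ⊆ W₀, U.Nonempty ∧ ∀ v ∈ U, d / 4 ≤ ∑ u ∈ U, w v u ∧ ∑ u ∈ U, w v u ≤ K * d := by
  set m : ℝ := (W₀.card : ℝ) with hm
  have hm0 : 0 < m := by rw [hm]; exact_mod_cast hne.card_pos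
  have hma : 0 < m ^ a := Real.rpow_pos_of_pos hm0 a
  have hρ : 0 < ρ := by
    by_contra! h
    have := mul_nonpos_of_nonpos_of_nonneg h hma.le
    linarith
  have hK0 : 0 < K := by rw [hK]; positivity
  have hKa : (2 / K) ^ a = 1 / 32 := by
    have h1 : 2 / K = (32 ^ (1 / a) : ℝ)⁻¹ := by rw [hK]; field_simp
    rw [h1, Real.inv_rpow (by positivity), ← Real.rpow_mul (by norm_num),
      one_div_mul_cancel ha.ne', Real.rpow_one]
    norm_num
  set H := W₀.filter fun v => K * d < ∑ u ∈ W₀, w v u with hH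
  have hHW : H ⊆ W₀ := Finset.filter_subset _ _
  set k : ℝ := (H.card : ℝ) with hk
  have hHbound : pairWeight w H W₀ ≤ d * m / 16 := by
    rcases H.eq_empty_or_nonempty with hemp | hHne
    · rw [hemp]; simp only [pairWeight, Finset.sum_empty]; positivity
    have hk0 : 0 < k := by rw [hk]; exact_mod_cast hHne.card_pos
    have h1 : K * d * k ≤ pairWeight w H W₀ :=
      mul_card_le_pairWeight fun v hv => (Finset.mem_filter.1 hv).2.le
    have h2 := pairWeight_mono_left h0 hHW W₀
    have h3 : K * k ≤ m := by
      have : d * (K * k) ≤ d * m := by linarith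
      exact le_of_mul_le_mul_left this hd0
    -- Pairing `H` with its best `k` partners gives a set of at most 2k ≤ (2 / K) m vertices, to
    -- which sparseness applies; `K` is chosen so that (2 / K)^a = 1/32.
    obtain ⟨Y, hY, hYk, hYsum⟩ := exists_subset_card_eq_average_le (fun y => ∑ x ∈ H, w x y)
      H.card W₀ (Finset.card_le_card hHW)
    have e1 : ∑ y ∈ W₀, ∑ x ∈ H, w x y = pairWeight w H W₀ := Finset.sum_comm
    have e2 : ∑ y ∈ Y, ∑ x ∈ H, w x y = pairWeight w H Y := Finset.sum_comm
    rw [e1, e2, ← hk, ← hm] at hYsum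
    have e3 : pairWeight w H Y ≤ pairWeight w (H ∪ Y) (H ∪ Y) :=
      (pairWeight_mono_left h0 Finset.subset_union_left Y).trans
        (pairWeight_mono_right h0 Finset.subset_union_right _)
    have e4 : ((H ∪ Y).card : ℝ) ≤ 2 * k := by
      have := Finset.card_union_le H Y
      rw [hYk] at this
      have : ((H ∪ Y).card : ℝ) ≤ H.card + H.card := by exact_mod_cast this
      linarith
    have e5 : ((H ∪ Y).card : ℝ) ^ (1 + a) ≤ (2 * k) ^ (1 + a) :=
      Real.rpow_le_rpow (Nat.cast_nonneg _) e4 (by linarith)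
    have e6 : (2 * k) ^ (1 + a) = 2 * k * (2 * k) ^ a := by
      rw [Real.rpow_add (by linarith), Real.rpow_one]
    have e7 : (2 * k) ^ a ≤ m ^ a / 32 := by
      have : 2 * k ≤ 2 / K * m := by
        rw [div_mul_eq_mul_div, le_div_iff₀ hK0]; linarith
      refine (Real.rpow_le_rpow (by linarith) this ha.le).trans ?_
      rw [Real.mul_rpow (by positivity) hm0.le, hKa]
      linarith
    have e8 : k * pairWeight w H W₀ ≤ k * (d * m / 16) := by
      calc k * pairWeight w H W₀ ≤ m * pairWeight w H Y := hYsum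
        _ ≤ m * (ρ * (2 * k * (m ^ a / 32))) := by
          refine mul_le_mul_of_nonneg_left (e3.trans ((hsparse _).trans ?_)) hm0.le
          refine mul_le_mul_of_nonneg_left (e5.trans ?_) hρ.le
          rw [e6]
          exact mul_le_mul_of_nonneg_left e7 (by linarith)
        _ = k * (d * m / 16) := by rw [hd]; ring
    exact le_of_mul_le_mul_left e8 hk0
  set W₁ := W₀ \ H with hW₁
  have hW₁W : W₁ ⊆ W₀ := Finset.sdiff_subset
  have hW₁w : 7 / 8 * (d * m) ≤ pairWeight w W₁ W₁ := by
    have e1 := pairWeight_self_sdiff hw hW₁W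
    rw [hW₁, Finset.sdiff_sdiff_eq_self hHW] at e1
    have e2 := pairWeight_nonneg h0 H H
    rw [hW₁]
    linarith
  -- At a maximiser, deleting `v` loses at most twice its degree and gains d / 2, so every degree is
  -- at least d / 4.
  obtain ⟨U, hU, hmax⟩ := Finset.exists_max_image W₁.powerset
    (fun X => pairWeight w X X - d / 2 * X.card) ⟨W₁, Finset.mem_powerset_self _⟩
  rw [Finset.mem_powerset] at hU
  refine ⟨U, hU.trans hW₁W, ?_, fun v hv => ⟨?_, ?_⟩⟩
  · rw [Finset.nonempty_iff_ne_empty]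
    rintro rfl
    have e1 := hmax W₁ (Finset.mem_powerset_self _)
    have e2 : (W₁.card : ℝ) ≤ m := by rw [hm]; exact_mod_cast Finset.card_le_card hW₁W
    have e3 : d / 2 * W₁.card ≤ d / 2 * m := mul_le_mul_of_nonneg_left e2 (by linarith)
    have e4 : 0 < d * m := mul_pos hd0 hm0
    simp only [pairWeight, Finset.sum_empty, Finset.card_empty, Nat.cast_zero] at e1
    simp only [pairWeight] at hW₁w
    linarith
  · have hsub : ({v} : Finset V) ⊆ U := Finset.singleton_subset_iff.2 hv
    have e1 := hmax (U \ {v}) (Finset.mem_powerset.2 (Finset.sdiff_subset.trans hU))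
    have e2 := pairWeight_self_sdiff hw (Finset.sdiff_subset : U \ {v} ⊆ U)
    rw [Finset.sdiff_sdiff_eq_self hsub] at e2
    have e3 : pairWeight w {v} U = ∑ u ∈ U, w v u := by simp [pairWeight]
    have e4 := pairWeight_nonneg h0 {v} {v}
    have e5 : ((U \ {v}).card : ℝ) + 1 = U.card := by
      have := Finset.card_sdiff_add_card_eq_card hsub
      rw [Finset.card_singleton] at this
      exact_mod_cast this
    rw [e3] at e2
    rw [← e5] at e1
    linarith
  · have hvW := hU hv
    have e1 : ∑ u ∈ W₀, w v u ≤ K * d := by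
      by_contra! h
      exact (Finset.mem_sdiff.1 hvW).2 (Finset.mem_filter.2 ⟨hW₁W hvW, h⟩)
    exact (Finset.sum_le_sum_of_subset_of_nonneg (hU.trans hW₁W) fun u _ _ => h0 v u).trans e1

/-! ### Sampling to near-regularity and assembly of the regular factor. -/

/-- A sparse-everywhere bipartite graph of almost regular degrees can be sampled to a nearly regular
weighted graph. -/
theorem exists_nearly_regular_sample {V : Type*} [Fintype V] [DecidableEq V] {w : V → V → ℝ}
    (hw : ∀ u v, w u v = w v u) (h0 : ∀ u v, 0 ≤ w u v)
    {U : Finset V} (hU : U.Nonempty) {δ Δ : ℝ} (hδ : 0 < δ)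
    (hlow : ∀ v ∈ U, δ ≤ ∑ u ∈ U, w v u) (hup : ∀ v ∈ U, ∑ u ∈ U, w v u ≤ Δ)
    (h1 : ∀ u v, w u v ≤ 1) {R γ : ℝ} (hR : R = δ ^ 2 / Δ) (hγ0 : 0 < γ) (hγ1 : γ < 1)
    (hsmall : (Fintype.card V : ℝ) * (2 * Real.exp (-(γ ^ 2 * R / 4))) < 1) :
    ∃ S ⊆ U, S.Nonempty ∧ ∃ w' : V → V → ℝ, (∀ u v, w' u v = w' v u) ∧ (∀ u v, 0 ≤ w' u v) ∧
      (∀ u v, w' u v ≤ w u v) ∧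
      ∀ v ∈ S, (1 - γ) * R ≤ ∑ u ∈ S, w' v u ∧ ∑ u ∈ S, w' v u ≤ (1 + γ) * R := by
  set D : V → ℝ := fun v => ∑ u ∈ U, w v u with hD
  have hDpos : ∀ v ∈ U, 0 < D v := fun v hv => hδ.trans_le (hlow v hv)
  obtain ⟨v₀, hv₀⟩ := hU
  have hΔ : 0 < Δ := (hDpos v₀ hv₀).trans_le (hup v₀ hv₀)
  have hRpos : 0 < R := by rw [hR]; positivity
  set p : V → ℝ := fun u => if u ∈ U then D u / Δ else 0 with hp
  set w' : V → V → ℝ := fun u v => if u ∈ U ∧ v ∈ U then w u v * (δ ^ 2 / (D u * D v)) else 0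
    with hw'
  have hfac : ∀ u ∈ U, ∀ v ∈ U, 0 ≤ δ ^ 2 / (D u * D v) ∧ δ ^ 2 / (D u * D v) ≤ 1 := by
    intro u hu v hv
    have hpos := mul_pos (hDpos u hu) (hDpos v hv)
    refine ⟨by positivity, (div_le_one hpos).2 ?_⟩
    rw [sq]
    exact mul_le_mul (hlow u hu) (hlow v hv) hδ.le (hDpos u hu).le
  have hw'0 : ∀ u v, 0 ≤ w' u v := by
    intro u v
    simp only [hw']
    split_ifs with h
    · exact mul_nonneg (h0 u v) (hfac u h.1 v h.2).1
    · exact le_rfl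
  have hw'w : ∀ u v, w' u v ≤ w u v := by
    intro u v
    simp only [hw']
    split_ifs with h
    · exact mul_le_of_le_one_right (h0 u v) (hfac u h.1 v h.2).2
    · exact h0 u v
  -- The sampling probability cancels `D u`, and summing w(v,u) over `U` cancels `D v`, leaving δ² /
  -- Δ for every `v`.
  have hmean : ∀ v ∈ U, ∑ u, p u * w' v u = R := by
    intro v hv
    have e1 : ∀ u, p u * w' v u = if u ∈ U then w v u * (δ ^ 2 / (Δ * D v)) else 0 := by
      intro u
      simp only [hp, hw']
      by_cases hu : u ∈ U
      · have := (hDpos u hu).ne'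
        have := (hDpos v hv).ne'
        simp only [hu, hv, and_self, if_true]
        field_simp
      · simp [hu]
    rw [Finset.sum_congr rfl fun u _ => e1 u, Finset.sum_ite_mem, Finset.univ_inter,
      ← Finset.sum_mul, hR]
    have := (hDpos v hv).ne'
    change D v * _ = _
    field_simp
  obtain ⟨S, hS⟩ := exists_subset_sum_concentrated p
    (fun u => by
      simp only [hp]
      split_ifs with h
      · exact div_nonneg (hDpos u h).le hΔ.le
      · exact le_rfl)
    (fun u => by
      simp only [hp]
      split_ifs with h
      · exact (div_le_one hΔ).2 (hup u h)
      · exact zero_le_one)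
    U w' (fun v _ u => hw'0 v u) (fun v _ u => (hw'w v u).trans (h1 v u)) R hmean γ hγ0 hγ1.le
    (lt_of_le_of_lt (mul_le_mul_of_nonneg_right (by exact_mod_cast Finset.card_le_univ U)
      (by positivity)) hsmall)
  have hsum : ∀ v, ∑ u ∈ S ∩ U, w' v u = ∑ u ∈ S, w' v u := by
    intro v
    refine Finset.sum_subset Finset.inter_subset_left fun u hu hnu => ?_
    have : u ∉ U := fun h => hnu (Finset.mem_inter.2 ⟨hu, h⟩)
    simp [hw', this]
  refine ⟨S ∩ U, Finset.inter_subset_right, ?_, w', ?_, hw'0, hw'w, fun v hv => ?_⟩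
  · rw [Finset.nonempty_iff_ne_empty]
    intro hemp
    have e1 := (hS v₀ hv₀).1
    rw [← hsum, hemp, Finset.sum_empty] at e1
    have : 0 < (1 - γ) * R := mul_pos (by linarith) hRpos
    linarith
  · intro u v
    simp only [hw', and_comm (a := u ∈ U), hw u v, mul_comm (D u)]
  · rw [hsum]
    exact hS v (Finset.mem_inter.1 hv).2

/-- A bipartite graph of extremal density contains a balanced vertex set spanning a regular subgraph
whose degree is proportional to the average degree. -/
theorem exists_regular_of_extremal {a : ℝ} (ha : 0 < a) :
    ∃ κ > 0, ∃ D > 0, ∃ η > 0, ∀ {V : Type*} [Fintype V] [DecidableEq V] {w : V → V → ℝ},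
      (∀ u v, w u v = w v u) → (∀ u v, w u v = 0 ∨ w u v = 1) →
      ∀ {P : Finset V}, (∀ u v, w u v ≠ 0 → (u ∈ P ↔ v ∉ P)) →
      ∀ {W₀ : Finset V} {ρ d : ℝ}, W₀.Nonempty → d = ρ * (W₀.card : ℝ) ^ a → D ≤ d →
        pairWeight w W₀ W₀ = ρ * (W₀.card : ℝ) ^ (1 + a) →
        (∀ W, pairWeight w W W ≤ ρ * (W.card : ℝ) ^ (1 + a)) →
        (Fintype.card V : ℝ) * (2 * Real.exp (-(η * d))) < 1 →
        ∃ U ⊆ W₀, U.Nonempty ∧ (U ∩ P).card = (U \ P).card ∧ ∃ r : ℕ, κ * d ≤ r ∧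
          ∃ F ⊆ (U ∩ P) ×ˢ (U \ P), (∀ e ∈ F, w e.1 e.2 = 1) ∧
            (∀ x ∈ U ∩ P, (F.filter fun e => e.1 = x).card = r) ∧
            ∀ y ∈ U \ P, (F.filter fun e => e.2 = y).card = r := by
  set K : ℝ := 2 * 32 ^ (1 / a) with hK
  have hK0 : 0 < K := by positivity
  set L : ℕ := ⌈(128 * K) ^ (1 / a)⌉₊ with hL
  have hL1 : 1 ≤ L := Nat.one_le_iff_ne_zero.2 (Nat.ceil_pos.2 (by positivity)).ne'
  have hLr : (0 : ℝ) < L := by exact_mod_cast hL1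
  have hLa : 128 * K ≤ (L : ℝ) ^ a := by
    have h := Real.rpow_le_rpow (by positivity) (Nat.le_ceil ((128 * K) ^ (1 / a))) ha.le
    rwa [← Real.rpow_mul (by positivity), one_div_mul_cancel ha.ne', Real.rpow_one] at h
  set γ : ℝ := 1 / (320 * L * 1000 ^ L) with hγ
  have hγ0 : 0 < γ := by positivity
  have hγ1 : γ < 1 := by
    rw [hγ, div_lt_one (by positivity)]
    have h1 : (1 : ℝ) ≤ 1000 ^ L := one_le_pow₀ (by norm_num)
    have h2 : (1 : ℝ) ≤ L := by exact_mod_cast hL1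
    nlinarith
  -- Here R = d / (16 K). The bound d ≥ 4L gives |W₀| ≥ 4L, since d ≤ |W₀|; d ≥ 64K gives ⌊R/2⌋ ≥
  -- R/4 = κ d; and η d = γ² R / 4 is the Chernoff exponent. The size of `L` makes sets of at most
  -- |W₀| / L vertices have average degree at most R / 8.
  refine ⟨1 / (64 * K), by positivity, 4 * L + 64 * K, by positivity, γ ^ 2 / (64 * K),
    by positivity, ?_⟩
  intro V _ _ w hw h01 P hbip W₀ ρ d hne hd hDd hW₀ hsparse hexp
  have h0 : ∀ u v, 0 ≤ w u v := fun u v => by rcases h01 u v with h | h <;> simp [h]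
  have h1 : ∀ u v, w u v ≤ 1 := fun u v => by rcases h01 u v with h | h <;> simp [h]
  have hd0 : 0 < d := lt_of_lt_of_le (by positivity) hDd
  have hm0 : (0 : ℝ) < W₀.card := by exact_mod_cast hne.card_pos
  have hW₀d : pairWeight w W₀ W₀ = d * W₀.card := by
    rw [hW₀, Real.rpow_add hm0, Real.rpow_one, hd]; ring
  have hρ : 0 < ρ := by
    by_contra! h
    have := mul_nonpos_of_nonpos_of_nonneg h (Real.rpow_pos_of_pos hm0 a).le
    linarith
  have hdm : d ≤ W₀.card := by
    have h2 : pairWeight w W₀ W₀ ≤ W₀.card * W₀.card := by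
      refine pairWeight_le_mul_card fun v _ => ?_
      have := Finset.sum_le_card_nsmul W₀ (fun u => w v u) 1 fun u _ => h1 v u
      simpa using this
    rw [hW₀d] at h2
    exact le_of_mul_le_mul_right h2 hm0
  obtain ⟨U, hUW, hUne, hUdeg⟩ :=
    exists_almost_regular_subset hw h0 ha hne hd hd0 hW₀d hsparse hK
  set R : ℝ := (d / 4) ^ 2 / (K * d) with hR
  have hR' : R = d / (16 * K) := by rw [hR]; field_simp; norm_num
  have hR0 : 0 < R := by rw [hR']; positivity
  obtain ⟨S, hSU, hSne, w', hw's, hw'0, hw'w, hSdeg⟩ := exists_nearly_regular_sample hw h0 hUne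
    (by positivity : 0 < d / 4) (fun v hv => (hUdeg v hv).1) (fun v hv => (hUdeg v hv).2) h1 hR
    hγ0 hγ1 (by
      convert hexp using 5
      rw [hR']
      field_simp
      norm_num)
  have hbip' : ∀ u v, w' u v ≠ 0 → (u ∈ P ↔ v ∉ P) := fun u v h => hbip u v fun hz =>
    h (le_antisymm (hz ▸ hw'w u v) (hw'0 u v))
  have hle : ∀ X Y : Finset V, pairWeight w' X Y ≤ pairWeight w X Y := fun X Y =>
    Finset.sum_le_sum fun u _ => Finset.sum_le_sum fun v _ => hw'w u v
  obtain ⟨T, hTS, hTne, hTbal, hall⟩ := exists_balanced_hall hw's hw'0 hbip' hSne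
    (m := W₀.card) hL1
    (by
      have : (4 * L : ℝ) ≤ W₀.card := by linarith
      exact_mod_cast this)
    (Finset.card_le_card (hSU.trans hUW)) hR0 hγ (fun v hv => (hSdeg v hv).1)
    (fun v hv => (hSdeg v hv).2) (fun W hW hWm => by
      refine (hle W W).trans ((hsparse W).trans ?_)
      rcases W.eq_empty_or_nonempty with rfl | hWne
      · simp [Real.zero_rpow (by linarith : (1 + a) ≠ 0)]
      have hWpos : (0 : ℝ) < W.card := by exact_mod_cast hWne.card_pos
      have e1 : (L : ℝ) ^ a * (W.card : ℝ) ^ a ≤ (W₀.card : ℝ) ^ a := by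
        rw [← Real.mul_rpow hLr.le hWpos.le]
        exact Real.rpow_le_rpow (by positivity) hWm ha.le
      have e2 : 128 * K * (W.card : ℝ) ^ a ≤ (W₀.card : ℝ) ^ a :=
        (mul_le_mul_of_nonneg_right hLa (Real.rpow_nonneg hWpos.le a)).trans e1
      rw [Real.rpow_add hWpos, Real.rpow_one]
      have e3 : ρ * (W.card : ℝ) ^ a ≤ R / 8 := by
        rw [hR', hd, div_div, le_div_iff₀ (by positivity)]
        calc ρ * (W.card : ℝ) ^ a * (16 * K * 8) = ρ * (128 * K * (W.card : ℝ) ^ a) := by ring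
          _ ≤ _ := mul_le_mul_of_nonneg_left e2 hρ.le
      calc ρ * (W.card * (W.card : ℝ) ^ a) = ρ * (W.card : ℝ) ^ a * W.card := by ring
        _ ≤ _ := mul_le_mul_of_nonneg_right e3 hWpos.le)
  set r : ℕ := ⌊R / 2⌋₊ with hr
  have hrle : (r : ℝ) ≤ R / 2 := Nat.floor_le (by positivity)
  have hrge : 1 / (64 * K) * d ≤ r := by
    have e1 : R / 2 - 1 < r := Nat.sub_one_lt_floor _
    have e2 : 1 ≤ R / 4 := by
      rw [hR', div_div, le_div_iff₀ (by positivity)]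
      linarith
    have e3 : 1 / (64 * K) * d = R / 4 := by rw [hR']; field_simp; norm_num
    linarith
  refine ⟨T, (hTS.trans hSU).trans hUW, hTne, hTbal, r, hrge, ?_⟩
  set E := ((T ∩ P) ×ˢ (T \ P)).filter fun e => w e.1 e.2 = 1 with hE
  obtain ⟨F, hFE, hF1, hF2⟩ := exists_regular_factor E (T ∩ P) (T \ P) (Finset.filter_subset _ _)
    hTbal r (fun X hX Z hZ => by
      have e1 := (hall X hX Z hZ).trans (hle _ _)
      have e2 : pairWeight w X ((T \ P) \ Z) =
          ((E.filter fun e => e.1 ∈ X ∧ e.2 ∉ Z).card : ℝ) := by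
        have e3 : (E.filter fun e => e.1 ∈ X ∧ e.2 ∉ Z) =
            (X ×ˢ ((T \ P) \ Z)).filter fun e => w e.1 e.2 = 1 := by
          ext e
          have := @hX e.1
          simp only [hE, Finset.mem_filter, Finset.mem_product, Finset.mem_sdiff (s := T \ P)]
          tauto
        rw [e3, ← Finset.sum_boole, Finset.sum_product]
        refine Finset.sum_congr rfl fun u _ => Finset.sum_congr rfl fun v _ => ?_
        rcases h01 u v with h | h <;> simp [h]
      rw [e2] at e1
      rcases le_total X.card Z.card with h | h
      · exact (Nat.mul_le_mul_left r h).trans (Nat.le_add_right _ _)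
      · have h' : (Z.card : ℝ) ≤ X.card := by exact_mod_cast h
        have e4 : (r : ℝ) * ((X.card : ℝ) - Z.card) ≤ R / 2 * ((X.card : ℝ) - Z.card) :=
          mul_le_mul_of_nonneg_right hrle (by linarith)
        have e5 : (r : ℝ) * X.card ≤ r * Z.card +
            ((E.filter fun e => e.1 ∈ X ∧ e.2 ∉ Z).card : ℝ) := by linarith
        exact_mod_cast e5)
  exact ⟨F, hFE.trans (Finset.filter_subset _ _), fun e he => (Finset.mem_filter.1 (hFE he)).2,
    hF1, hF2⟩

/-! ### Translation to and from graphs, and asymptotics. -/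

open Filter Topology

/-- Every graph has a bipartite subgraph with at least half of its edges. -/
theorem exists_bipartite_pairWeight_ge {V : Type*} [Fintype V] [DecidableEq V]
    (G : SimpleGraph V) :
    ∃ P : Finset V, ∃ w : V → V → ℝ, (∀ u v, w u v = w v u) ∧ (∀ u v, w u v = 0 ∨ w u v = 1) ∧
      (∀ u v, w u v ≠ 0 → (u ∈ P ↔ v ∉ P)) ∧ (∀ u v, w u v = 1 → G.Adj u v) ∧
      (G.edgeSet.ncard : ℝ) ≤ pairWeight w Finset.univ Finset.univ := by
  classical
  set g : V → V → ℝ := fun u v => if G.Adj u v then 1 else 0 with hg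
  have hgs : ∀ u v, g u v = g v u := fun u v => by simp only [hg, G.adj_comm]
  obtain ⟨P, -, hP⟩ := exists_cut_ge_half hgs (fun v => by simp [hg]) Finset.univ
  have hedges : pairWeight g Finset.univ Finset.univ = 2 * (G.edgeSet.ncard : ℝ) := by
    have e1 : ∀ u, ∑ v, g u v = (G.degree u : ℝ) := by
      intro u
      rw [hg, Finset.sum_boole, ← SimpleGraph.card_neighborFinset_eq_degree]
      congr 2
      ext v
      simp
    have e2 : G.edgeSet.ncard = G.edgeFinset.card := by
      rw [Set.ncard_eq_toFinset_card', SimpleGraph.edgeFinset]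
    unfold pairWeight
    rw [Finset.sum_congr rfl fun u _ => e1 u, e2]
    exact_mod_cast G.sum_degrees_eq_twice_card_edges
  set w : V → V → ℝ := fun u v => if G.Adj u v ∧ (u ∈ P ↔ v ∉ P) then 1 else 0 with hw
  have hws : ∀ u v, w u v = w v u := by
    intro u v
    simp only [hw, G.adj_comm u v]
    congr 2
    exact propext (by tauto)
  have hw0 : ∀ u v, 0 ≤ w u v := fun u v => by simp only [hw]; split_ifs <;> norm_num
  have hcross : pairWeight w P (Finset.univ \ P) = pairWeight g P (Finset.univ \ P) := by
    refine Finset.sum_congr rfl fun u hu => Finset.sum_congr rfl fun v hv => ?_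
    have : v ∉ P := (Finset.mem_sdiff.1 hv).2
    simp [hw, hg, hu, this]
  refine ⟨P, w, hws, fun u v => ?_, fun u v h => ?_, fun u v h => ?_, ?_⟩
  · simp only [hw]; split_ifs <;> simp
  · by_contra hne
    exact h (if_neg fun h' => hne h'.2)
  · by_contra hne
    have : w u v = 0 := if_neg fun h' => hne h'.1
    rw [this] at h
    exact zero_ne_one h
  -- The cut carries at least half the edges, and the ordered sum counts each of them twice.
  · have e1 := pairWeight_sdiff_left (w := w) (Finset.subset_univ P) Finset.univ
    have e2 := pairWeight_sdiff_right (w := w) (Finset.subset_univ P) P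
    have e3 := pairWeight_sdiff_right (w := w) (Finset.subset_univ P) (Finset.univ \ P)
    have e4 := pairWeight_comm hws (Finset.univ \ P) P
    have e5 := pairWeight_nonneg hw0 P P
    have e6 := pairWeight_nonneg hw0 (Finset.univ \ P) (Finset.univ \ P)
    linarith

/-- The subgraph formed by a set of edges, oriented from `P` to its complement, in which every
vertex of a balanced set `U` has degree `r`. -/
theorem exists_regular_subgraph_of_oriented_edges {V : Type*} [DecidableEq V] {G : SimpleGraph V}
    {P U : Finset V} {F : Finset (V × V)} {r : ℕ} (hF : F ⊆ (U ∩ P) ×ˢ (U \ P))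
    (hadj : ∀ e ∈ F, G.Adj e.1 e.2) (hbal : (U ∩ P).card = (U \ P).card)
    (h1 : ∀ x ∈ U ∩ P, (F.filter fun e => e.1 = x).card = r)
    (h2 : ∀ y ∈ U \ P, (F.filter fun e => e.2 = y).card = r) :
    ∃ H : G.Subgraph, H.verts = U ∧ (∀ v ∈ H.verts, (H.neighborSet v).ncard = r) ∧
      2 * H.edgeSet.ncard = r * U.card := by
  have hmem : ∀ {x y}, (x, y) ∈ F → x ∈ U ∧ x ∈ P ∧ y ∈ U ∧ y ∉ P := by
    intro x y h
    have := Finset.mem_product.1 (hF h)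
    exact ⟨(Finset.mem_inter.1 this.1).1, (Finset.mem_inter.1 this.1).2,
      (Finset.mem_sdiff.1 this.2).1, (Finset.mem_sdiff.1 this.2).2⟩
  let H : G.Subgraph :=
    { verts := U
      Adj := fun x y => (x, y) ∈ F ∨ (y, x) ∈ F
      adj_sub := fun {x y} h => h.elim (fun h => hadj _ h) fun h => (hadj _ h).symm
      edge_vert := fun {x y} h => h.elim (fun h => (hmem h).1) fun h => (hmem h).2.2.1
      symm := ⟨fun x y h => h.symm⟩ }
  refine ⟨H, rfl, fun v hv => ?_, ?_⟩
  · have hvU : v ∈ U := hv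
    by_cases hvP : v ∈ P
    · have e1 : H.neighborSet v = ((F.filter fun e => e.1 = v).image Prod.snd : Finset V) := by
        ext y
        simp only [SimpleGraph.Subgraph.mem_neighborSet, H, Finset.coe_image, Set.mem_image,
          Finset.mem_coe, Finset.mem_filter, Prod.exists, exists_eq_right]
        constructor
        · rintro (h | h)
          · exact h
          · exact absurd hvP (hmem h).2.2.2
        · intro h
          exact Or.inl h
      rw [e1, Set.ncard_coe_finset, Finset.card_image_of_injOn,
        h1 v (Finset.mem_inter.2 ⟨hvU, hvP⟩)]
      intro e he e' he' h
      exact Prod.ext (((Finset.mem_filter.1 he).2).trans ((Finset.mem_filter.1 he').2).symm) h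
    · have e1 : H.neighborSet v = ((F.filter fun e => e.2 = v).image Prod.fst : Finset V) := by
        ext y
        simp only [SimpleGraph.Subgraph.mem_neighborSet, H, Finset.coe_image, Set.mem_image,
          Finset.mem_coe, Finset.mem_filter, Prod.exists, exists_and_right, exists_eq_right]
        constructor
        · rintro (h | h)
          · exact absurd (hmem h).2.1 hvP
          · exact h
        · intro h
          exact Or.inr h
      rw [e1, Set.ncard_coe_finset, Finset.card_image_of_injOn,
        h2 v (Finset.mem_sdiff.2 ⟨hvU, hvP⟩)]
      intro e he e' he' h
      exact Prod.ext h (((Finset.mem_filter.1 he).2).trans ((Finset.mem_filter.1 he').2).symm)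
  · have e1 : H.edgeSet = (F.image fun e => s(e.1, e.2) : Finset (Sym2 V)) := by
      ext e
      induction e using Sym2.ind with
      | _ x y =>
        simp only [SimpleGraph.Subgraph.mem_edgeSet, H, Finset.coe_image, Set.mem_image,
          Finset.mem_coe, Prod.exists, Sym2.eq_iff]
        constructor
        · rintro (h | h)
          · exact ⟨x, y, h, Or.inl ⟨rfl, rfl⟩⟩
          · exact ⟨y, x, h, Or.inr ⟨rfl, rfl⟩⟩
        · rintro ⟨x', y', h, ⟨rfl, rfl⟩ | ⟨rfl, rfl⟩⟩
          · exact Or.inl h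
          · exact Or.inr h
    have e2 : H.edgeSet.ncard = F.card := by
      rw [e1, Set.ncard_coe_finset, Finset.card_image_of_injOn]
      rintro ⟨x, y⟩ h ⟨x', y'⟩ h' heq
      rcases Sym2.eq_iff.1 heq with ⟨h3, h4⟩ | ⟨h3, h4⟩
      · exact Prod.ext h3 h4
      · simp only at h3
        exact absurd (h3 ▸ (hmem h).2.1) (hmem h').2.2.2
    have e3 : F.card = (U ∩ P).card * r := by
      rw [Finset.card_eq_sum_card_fiberwise (f := Prod.fst) (t := U ∩ P)
        (fun e he => (Finset.mem_product.1 (hF he)).1), Finset.sum_congr rfl h1,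
        Finset.sum_const, smul_eq_mul]
    have e4 : (U ∩ P).card + (U \ P).card = U.card := Finset.card_inter_add_card_sdiff _ _
    rw [e2, e3, ← e4, ← hbal]
    ring

/-- Substitute x = n^a in the limit x^(1/a) exp(-b x) → 0. This supplies the union bound over
vertices in the sampling step. -/
theorem eventually_mul_exp_neg_rpow_lt_one {a b : ℝ} (ha : 0 < a) (hb : 0 < b) :
    ∀ᶠ n : ℕ in atTop, (n : ℝ) * (2 * Real.exp (-(b * (n : ℝ) ^ a))) < 1 := by
  have h1 := tendsto_rpow_mul_exp_neg_mul_atTop_nhds_zero (1 / a) b hb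
  have h2 : Tendsto (fun n : ℕ => (n : ℝ) ^ a) atTop atTop :=
    (tendsto_rpow_atTop ha).comp tendsto_natCast_atTop_atTop
  have h3 := (h1.comp h2).eventually (gt_mem_nhds (by norm_num : (0 : ℝ) < 1 / 2))
  filter_upwards [h3] with n hn
  simp only [Function.comp] at hn
  rw [← Real.rpow_mul (Nat.cast_nonneg n), mul_one_div_cancel ha.ne', Real.rpow_one, neg_mul] at hn
  linarith

theorem eventually_le_mul_rpow {a c : ℝ} (ha : 0 < a) (hc : 0 < c) (D : ℝ) :
    ∀ᶠ n : ℕ in atTop, D ≤ c * (n : ℝ) ^ a := by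
  have h2 : Tendsto (fun n : ℕ => c * (n : ℝ) ^ a) atTop atTop :=
    ((tendsto_rpow_atTop ha).comp tendsto_natCast_atTop_atTop).const_mul_atTop hc
  exact h2.eventually_ge_atTop D

/-! ### The main theorem. -/

theorem theorem1p13 (ε : ℝ) (hε0 : 0 < ε) (hε1 : ε < 1) :
    ∃ β : ℝ, 0 < β ∧
      ∀ c : ℝ, 0 < c →
        ∃ N : ℕ, ∀ n : ℕ, N ≤ n →
          ∀ (V : Type u) [Fintype V] (G : SimpleGraph V),
            Fintype.card V = n →
            c * (n : ℝ) ^ (1 + ε) ≤ (G.edgeSet.ncard : ℝ) →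
            ∃ H : G.Subgraph,
              SubgraphIsRegular H ∧
              (n : ℝ) ^ β ≤ (H.verts.ncard : ℝ) ∧
              β * c * (H.verts.ncard : ℝ) ^ (1 + ε) ≤ (H.edgeSet.ncard : ℝ) := by
  -- Half the exponent measures extremal density; the other half survives as ρ ≥ c n^a.
  obtain ⟨a, rfl⟩ : ∃ a, ε = a + a := ⟨ε / 2, by ring⟩
  have ha : 0 < a := by linarith
  obtain ⟨κ, hκ, D, hD, η, hη, hmain⟩ := exists_regular_of_extremal ha
  refine ⟨min (κ / 2) (a / 2), by positivity, fun c hc => ?_⟩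
  set β := min (κ / 2) (a / 2) with hβ
  have hβκ : β ≤ κ / 2 := min_le_left _ _
  have hβa : β ≤ a / 2 := min_le_right _ _
  obtain ⟨N, hN⟩ := eventually_atTop.1 ((eventually_mul_exp_neg_rpow_lt_one ha (mul_pos hη hc)).and
    ((eventually_le_mul_rpow ha hc D).and ((eventually_le_mul_rpow (half_pos ha)
      (mul_pos hκ hc) 1).and (eventually_ge_atTop 1))))
  refine ⟨N, fun n hn V _ G hV hG => ?_⟩
  obtain ⟨hexp, hDn, hone, hn1⟩ := hN n hn
  have hn1r : (1 : ℝ) ≤ n := by exact_mod_cast hn1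
  have hn0 : (0 : ℝ) < n := by linarith
  classical
  have : Nonempty V := Fintype.card_pos_iff.1 (by omega)
  obtain ⟨P, w, hws, hw01, hbip, hwG, hwedges⟩ := exists_bipartite_pairWeight_ge G
  obtain ⟨W₀, ρ, hne, hW₀, hsparse, hρ⟩ := exists_extremal_set w ha
  set d := ρ * (W₀.card : ℝ) ^ a with hd
  have hρc : c * (n : ℝ) ^ a ≤ ρ := by
    refine le_trans ?_ hρ
    rw [hV, le_div_iff₀ (Real.rpow_pos_of_pos hn0 _), mul_assoc, ← Real.rpow_add hn0]
    refine le_trans (le_of_eq ?_) (hG.trans hwedges)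
    congr 2
    ring
  have hm1 : (1 : ℝ) ≤ W₀.card := by exact_mod_cast hne.card_pos
  have hmn : (W₀.card : ℝ) ≤ n := by rw [← hV]; exact_mod_cast Finset.card_le_univ W₀
  have hma : 1 ≤ (W₀.card : ℝ) ^ a := Real.one_le_rpow hm1 ha.le
  have hcn : 0 < c * (n : ℝ) ^ a := mul_pos hc (Real.rpow_pos_of_pos hn0 a)
  have hdρ : ρ ≤ d := le_mul_of_one_le_right (hcn.le.trans hρc) hma
  have hdc : c * (n : ℝ) ^ a ≤ d := hρc.trans hdρ
  obtain ⟨U, hUW, hUne, hbal, r, hr, F, hF, hFw, hF1, hF2⟩ := hmain hws hw01 hbip hne hd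
    (hDn.trans hdc) hW₀ hsparse (by
      rw [hV]
      refine lt_of_le_of_lt ?_ hexp
      have : η * c * (n : ℝ) ^ a ≤ η * d := by
        rw [mul_assoc]; exact mul_le_mul_of_nonneg_left hdc hη.le
      gcongr)
  obtain ⟨H, hHU, hHdeg, hHedge⟩ := exists_regular_subgraph_of_oriented_edges hF
    (fun e he => hwG _ _ (hFw e he)) hbal hF1 hF2
  have hHcard : H.verts.ncard = U.card := by rw [hHU, Set.ncard_coe_finset]
  have hU1 : (1 : ℝ) ≤ U.card := by exact_mod_cast hUne.card_pos
  have hU0 : (0 : ℝ) < U.card := by linarith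
  -- The lower bound on the number of vertices comes only from the degree: |U| ≥ r ≥ κ c n^a, which
  -- exceeds n^(a/2) for large `n`.
  have hrU : (r : ℝ) ≤ U.card := by
    obtain ⟨v, hv⟩ := hUne
    have hvH : v ∈ H.verts := by rw [hHU]; exact hv
    have h1 : (H.neighborSet v).ncard ≤ H.verts.ncard :=
      Set.ncard_le_ncard (H.neighborSet_subset_verts v) (by rw [hHU]; exact U.finite_toSet)
    rw [hHdeg v hvH, hHcard] at h1
    exact_mod_cast h1
  refine ⟨H, ⟨r, hHdeg⟩, ?_, ?_⟩
  · rw [hHcard]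
    refine le_trans ?_ hrU
    calc (n : ℝ) ^ β ≤ (n : ℝ) ^ (a / 2) := Real.rpow_le_rpow_of_exponent_le hn1r hβa
      _ ≤ κ * c * (n : ℝ) ^ (a / 2) * (n : ℝ) ^ (a / 2) :=
        le_mul_of_one_le_left (Real.rpow_nonneg hn0.le _) hone
      _ = κ * (c * (n : ℝ) ^ a) := by
        rw [mul_assoc (κ * c), ← Real.rpow_add hn0, add_halves, mul_assoc]
      _ ≤ κ * d := mul_le_mul_of_nonneg_left hdc hκ.le
      _ ≤ r := hr
  · rw [hHcard]
    have hUm : (U.card : ℝ) ≤ W₀.card := by exact_mod_cast Finset.card_le_card hUW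
    -- One factor |U|^a is absorbed by `ρ` through |U| ≤ n, the other by |W₀|^a.
    have h1 : c * (U.card : ℝ) ^ (a + a) ≤ d := by
      rw [Real.rpow_add hU0, ← mul_assoc]
      have h2 : (U.card : ℝ) ^ a ≤ (W₀.card : ℝ) ^ a := Real.rpow_le_rpow hU0.le hUm ha.le
      have h3 : (U.card : ℝ) ^ a ≤ (n : ℝ) ^ a := Real.rpow_le_rpow hU0.le (hUm.trans hmn) ha.le
      exact mul_le_mul ((mul_le_mul_of_nonneg_left h3 hc.le).trans hρc) h2
        (Real.rpow_nonneg hU0.le a) (hcn.le.trans hρc)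
    have h4 : κ * (c * (U.card : ℝ) ^ (a + a)) ≤ r :=
      (mul_le_mul_of_nonneg_left h1 hκ.le).trans hr
    have h5 : 2 * (H.edgeSet.ncard : ℝ) = r * U.card := by exact_mod_cast hHedge
    have h6 : 0 ≤ c * (U.card : ℝ) ^ (a + a) * U.card := by positivity
    rw [Real.rpow_add hU0 1, Real.rpow_one]
    calc β * c * (U.card * (U.card : ℝ) ^ (a + a))
        = β * (c * (U.card : ℝ) ^ (a + a) * U.card) := by ring
      _ ≤ κ / 2 * (c * (U.card : ℝ) ^ (a + a) * U.card) := mul_le_mul_of_nonneg_right hβκ h6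
      _ = κ * (c * (U.card : ℝ) ^ (a + a)) * U.card / 2 := by ring
      _ ≤ r * U.card / 2 := by
        have := mul_le_mul_of_nonneg_right h4 hU0.le
        linarith
      _ = H.edgeSet.ncard := by linarith
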